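/- A (finite, abstract) simplicial complex is a non-empty finite set $\mathcal S$ of finite sets, called edges, that is closed under taking subsets; thus $\emptyset\in\mathcal S$. Its vertex set is $V(\mathcal S)=\bigcup_{S\in\mathcal S}S$, the degree of a vertex $x\in V(\mathcal S)$ is $d(x)=|\{e\in\mathcal S: x\in e\}|$, and the minimum degree is $\delta(\mathcal S)=\min\{d(x): x\in V(\mathcal S)\}$, with $\delta(\{\emptyset\})=\infty$. For an integer $k\ge 0$ let $\alpha(k)$ be the largest real number such that every simplicial complex $\mathcal S$ with $|\mathcal S|\le\alpha(k)\,|V(\mathcal S)|$ satisfies $\delta(\mathcal S)\le k$. Theorem. Let $d$ and $m$ be integers with $d\ge m\ge 1$. Then the maximum defining $\alpha(2^d-m)$ exists and $$\alpha(2^d-m)=\frac{2^{d+1}-m}{d+1}.$$ -/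

import Mathlib

universe u

/-- A finite abstract simplicial complex with vertices taken from `V`: a non-empty finite set of
finite sets (its edges) that is closed under taking subsets. In particular the empty set is always
an edge, and not every element of `V` has to be a vertex. -/
structure FinSimplicialComplex (V : Type u) where
  edges : Finset (Finset V)
  nonempty : edges.Nonempty
  down_closed : ∀ s ∈ edges, ∀ t ⊆ s, t ∈ edges

namespace FinSimplicialComplex

variable {V : Type u} [DecidableEq V]

/-- The vertex set `V(S)`, the union of all edges. -/
def vertexSet (S : FinSimplicialComplex V) : Finset V :=
  S.edges.biUnion id

/-- The degree of `x`: the number of edges containing `x`. -/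
def degree (S : FinSimplicialComplex V) (x : V) : ℕ :=
  (S.edges.filter fun e => x ∈ e).card

/-- The minimum degree over all vertices; it is `⊤` for the trivial complex `{∅}`. -/
noncomputable def minDegree (S : FinSimplicialComplex V) : ℕ∞ :=
  S.vertexSet.inf fun x => (S.degree x : ℕ∞)

end FinSimplicialComplex

/-- The set of all reals `a` such that every finite simplicial complex `S` with
`|S| ≤ a * |V(S)|` has minimum degree at most `k`. -/
def minDegreeConstants (k : ℕ) : Set ℝ :=
  {a | ∀ (V : Type u) [DecidableEq V] (S : FinSimplicialComplex V),
    (S.edges.card : ℝ) ≤ a * (S.vertexSet.card : ℝ) → S.minDegree ≤ (k : ℕ∞)}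

/-- The number `α(k)`. It is written as a supremum; that it is a maximum is part of the theorem. -/
noncomputable def minDegreeAlpha (k : ℕ) : ℝ :=
  sSup (minDegreeConstants.{u} k)

/-! Give each edge `e` the weight `1/|e|` at each of its vertices. Summed over all vertices the
weights count the non-empty edges, and the weight at `x` is the sum of `1/(|f|+1)` over the link of
`x`, a lower set with at least `2^d - m + 1` members. So it suffices that the average weight is at
least `alphaValue d m`; the empty edge then supplies the strictness that makes the supremum a
maximum.

Among lower sets of given size, initial segments of the binary order minimise `∑ t^|f|` for every
`t` in `[0,1]` (`IsLowerSet.colexPoly_le_sizePoly`); integrating over `t` bounds the weight of a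
link. For `m ≤ 2` this settles every vertex. For `m ≥ 3` single vertices may fall short and weight
must be redistributed.

Let `d ≥ 4`. A link with more than `d` vertices still has enough weight, so only tight vertices,
those with closed neighbourhood of size `d + 1`, can be deficient. These neighbourhoods `A` act as
classes: two of them sharing a tight vertex of both coincide. The edges inside `A` fall short of the
target by at most `excess`, which compares the number of subsets of `A` outside the complex with `m
- 1`. By `le_sum_of_card_missing` the non-tight vertices of `A` carry enough weight on edges leaving
`A` to cover this, and by `LargeDegrees.sum_transfer_le` a vertex in several classes can afford all
of them. The case `d = m = 3` has its own discharging: the only deficient links are paths with two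
edges.

For sharpness, take many disjoint copies of a power set on `d + 1` points with `m - 1` sets removed
from the top; the shared empty edge becomes negligible. -/

set_option linter.unusedSectionVars false

/-! ### Binary digit sums. -/

/-- The sum of the binary digits. -/
def binaryWeight (n : ℕ) : ℕ := (Nat.digits 2 n).sum

theorem binaryWeight_zero : binaryWeight 0 = 0 := by simp [binaryWeight]

theorem binaryWeight_two_mul (n : ℕ) : binaryWeight (2 * n) = binaryWeight n := by
  rcases Nat.eq_zero_or_pos n with rfl | hn
  · rfl
  · have := Nat.digits_add_two_add_one 0 (2 * n - 1)
    unfold binaryWeight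
    rw [show 2 * n = 2 * n - 1 + 1 by omega, this]
    rw [show 2 * n - 1 + 1 = 2 * n by omega]
    simp

theorem binaryWeight_two_mul_add_one (n : ℕ) :
    binaryWeight (2 * n + 1) = binaryWeight n + 1 := by
  unfold binaryWeight
  rw [Nat.digits_add_two_add_one 0 (2 * n), show (2 * n + 1) / (0 + 2) = n by omega,
    show (2 * n + 1) % (0 + 2) = 1 by omega, List.sum_cons, add_comm]

theorem binaryWeight_pos {n : ℕ} (hn : 1 ≤ n) : 1 ≤ binaryWeight n := by
  induction n using Nat.strong_induction_on with
  | _ n ih =>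
    obtain ⟨k, rfl | rfl⟩ := Nat.even_or_odd' n
    · rw [binaryWeight_two_mul]
      exact ih k (by omega) (by omega)
    · rw [binaryWeight_two_mul_add_one]
      omega

theorem binaryWeight_succ_le (n : ℕ) : binaryWeight (n + 1) ≤ binaryWeight n + 1 := by
  induction n using Nat.strong_induction_on with
  | _ n ih =>
    obtain ⟨k, rfl | rfl⟩ := Nat.even_or_odd' n
    · rw [binaryWeight_two_mul_add_one, binaryWeight_two_mul]
    · rw [show 2 * k + 1 + 1 = 2 * (k + 1) by ring, binaryWeight_two_mul,
        binaryWeight_two_mul_add_one]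
      have := ih k (by omega)
      omega

/-- The least number with `w` binary ones is `2^w - 1`. -/
theorem two_pow_binaryWeight_le (n : ℕ) : 2 ^ binaryWeight n ≤ n + 1 := by
  induction n using Nat.strong_induction_on with
  | _ n ih =>
    obtain ⟨k, rfl | rfl⟩ := Nat.even_or_odd' n
    · rw [binaryWeight_two_mul]
      rcases Nat.eq_zero_or_pos k with rfl | hk
      · simp [binaryWeight_zero]
      · have := ih k (by omega)
        omega
    · rw [binaryWeight_two_mul_add_one, pow_succ]
      have := ih k (by omega)
      omega

theorem binaryWeight_complement (d : ℕ) :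
    ∀ i < 2 ^ d, binaryWeight (2 ^ d - 1 - i) + binaryWeight i = d := by
  induction d with
  | zero =>
    intro i hi
    have : i = 0 := by simpa using hi
    simp [this, binaryWeight_zero]
  | succ d ih =>
    intro i hi
    rw [pow_succ] at hi ⊢
    obtain ⟨k, rfl | rfl⟩ := Nat.even_or_odd' i
    · rw [show 2 ^ d * 2 - 1 - 2 * k = 2 * (2 ^ d - 1 - k) + 1 by omega,
        binaryWeight_two_mul_add_one, binaryWeight_two_mul]
      have := ih k (by omega)
      omega
    · rw [show 2 ^ d * 2 - 1 - (2 * k + 1) = 2 * (2 ^ d - 1 - k) by omega,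
        binaryWeight_two_mul_add_one, binaryWeight_two_mul]
      have := ih k (by omega)
      omega

/-! ### Size polynomials of initial segments. -/

/-- The generating polynomial of the sizes of the first `N` finite subsets of `ℕ` in the
binary (colexicographic) order. -/
def colexPoly (t : ℝ) (N : ℕ) : ℝ := ∑ i ∈ Finset.range N, t ^ binaryWeight i

section colexPoly

variable {t : ℝ}

theorem colexPoly_zero : colexPoly t 0 = 0 := by simp [colexPoly]

theorem colexPoly_succ (n : ℕ) : colexPoly t (n + 1) = colexPoly t n + t ^ binaryWeight n :=
  Finset.sum_range_succ _ _

theorem colexPoly_one : colexPoly t 1 = 1 := by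
  rw [colexPoly_succ, colexPoly_zero, binaryWeight_zero]; simp

theorem colexPoly_two_mul (n : ℕ) : colexPoly t (2 * n) = (1 + t) * colexPoly t n := by
  induction n with
  | zero => simp [colexPoly_zero]
  | succ n ih =>
    rw [show 2 * (n + 1) = 2 * n + 1 + 1 by ring, colexPoly_succ, colexPoly_succ, ih,
      colexPoly_succ, binaryWeight_two_mul, binaryWeight_two_mul_add_one]
    ring

theorem colexPoly_two_mul_add_one (n : ℕ) :
    colexPoly t (2 * n + 1) = colexPoly t (n + 1) + t * colexPoly t n := by
  rw [colexPoly_succ, colexPoly_two_mul, binaryWeight_two_mul, colexPoly_succ]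
  ring

theorem colexPoly_two_pow (k : ℕ) : colexPoly t (2 ^ k) = (1 + t) ^ k := by
  induction k with
  | zero => simp [colexPoly_one]
  | succ k ih => rw [pow_succ, mul_comm, colexPoly_two_mul, ih, pow_succ, mul_comm]

/-- Adding `2^k` to some `i < 2^k` adds exactly one binary digit 1. -/
theorem colexPoly_two_pow_add (k : ℕ) :
    ∀ a ≤ 2 ^ k, colexPoly t (2 ^ k + a) = colexPoly t (2 ^ k) + t * colexPoly t a := by
  induction k with
  | zero =>
    intro a ha
    have : a = 0 ∨ a = 1 := by simp at ha; omega
    rcases this with rfl | rfl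
    · simp [colexPoly_zero]
    · have := colexPoly_two_mul (t := t) 1
      norm_num [colexPoly_one] at this ⊢
      exact this
  | succ k ih =>
    intro a ha
    rw [pow_succ] at ha ⊢
    obtain ⟨b, rfl | rfl⟩ := Nat.even_or_odd' a
    · rw [show 2 ^ k * 2 + 2 * b = 2 * (2 ^ k + b) by ring, mul_comm (2 ^ k) 2,
        colexPoly_two_mul, colexPoly_two_mul, colexPoly_two_mul, ih b (by omega)]
      ring
    · rw [show 2 ^ k * 2 + (2 * b + 1) = 2 * (2 ^ k + b) + 1 by ring, mul_comm (2 ^ k) 2,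
        colexPoly_two_mul_add_one, colexPoly_two_mul_add_one, colexPoly_two_mul,
        ih b (by omega), show 2 ^ k + b + 1 = 2 ^ k + (b + 1) by ring, ih (b + 1) (by omega)]
      ring

theorem colexPoly_mono (h0 : 0 ≤ t) {a b : ℕ} (h : a ≤ b) : colexPoly t a ≤ colexPoly t b :=
  Finset.sum_le_sum_of_subset_of_nonneg (Finset.range_subset_range.2 h)
    fun _ _ _ => pow_nonneg h0 _

/-- The numerical core of the deletion–link induction, with `a` and `b` the sizes of deletion and
link. It is proved by halving both arguments; when both are odd, the step rests on
`binaryWeight_succ_le`. -/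
theorem colexPoly_add_le (h0 : 0 ≤ t) (h1 : t ≤ 1) (a : ℕ) :
    ∀ b ≤ a, colexPoly t (a + b) ≤ colexPoly t a + t * colexPoly t b := by
  induction a using Nat.strong_induction_on with
  | _ a ih =>
    intro b hb
    rcases Nat.eq_zero_or_pos b with rfl | hb0
    · simp [colexPoly_zero]
    rcases hb.eq_or_lt with rfl | hlt
    · rw [← two_mul, colexPoly_two_mul]
      exact le_of_eq (by ring)
    obtain ⟨x, rfl | rfl⟩ := Nat.even_or_odd' a <;> obtain ⟨y, rfl | rfl⟩ := Nat.even_or_odd' b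
    · rw [← mul_add, colexPoly_two_mul, colexPoly_two_mul, colexPoly_two_mul]
      have := ih x (by omega) y (by omega)
      nlinarith
    · rw [show 2 * x + (2 * y + 1) = 2 * (x + y) + 1 by ring, colexPoly_two_mul_add_one,
        colexPoly_two_mul, colexPoly_two_mul_add_one]
      have e1 := ih x (by omega) (y + 1) (by omega)
      have e2 := ih x (by omega) y (by omega)
      rw [← add_assoc] at e1
      nlinarith
    · rw [show 2 * x + 1 + 2 * y = 2 * (x + y) + 1 by ring, colexPoly_two_mul_add_one,
        colexPoly_two_mul, colexPoly_two_mul_add_one]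
      have e1 := ih (x + 1) (by omega) y (by omega)
      have e2 := ih x (by omega) y (by omega)
      rw [add_right_comm] at e1
      nlinarith
    · rw [show 2 * x + 1 + (2 * y + 1) = 2 * (x + y + 1) by ring, colexPoly_two_mul_add_one,
        colexPoly_two_mul, colexPoly_two_mul_add_one]
      have e1 := ih (x + 1) (by omega) (y + 1) (by omega)
      have e2 := ih x (by omega) y (by omega)
      rw [show x + 1 + (y + 1) = x + y + 1 + 1 by ring, colexPoly_succ] at e1
      rw [colexPoly_succ (x + y)] at e1 ⊢
      have e3 : t ^ (binaryWeight (x + y) + 1) ≤ t ^ binaryWeight (x + y + 1) :=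
        pow_le_pow_of_le_one h0 h1 (binaryWeight_succ_le _)
      rw [pow_succ] at e3
      nlinarith

/-- A subadditivity in which the empty set is counted only once. It serves the stability estimate
`IsLowerSet.colexPoly_add_le_sizePoly`, after a full block `2^n` has been split off. -/
theorem colexPoly_add_one_le (h0 : 0 ≤ t) (h1 : t ≤ 1) (a : ℕ) :
    ∀ b, colexPoly t (a + b + 1) + 1 ≤ colexPoly t (a + 1) + colexPoly t (b + 1) := by
  have sub : ∀ a b, colexPoly t (a + b) ≤ colexPoly t a + colexPoly t b := by
    intro a b
    have pos : ∀ n, 0 ≤ colexPoly t n := fun n => Finset.sum_nonneg fun _ _ => pow_nonneg h0 _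
    rcases le_total b a with h | h
    · nlinarith [colexPoly_add_le h0 h1 a b h, pos b]
    · rw [add_comm a b]
      nlinarith [colexPoly_add_le h0 h1 b a h, pos a]
  induction a using Nat.strong_induction_on with
  | _ a ih =>
    intro b
    rcases Nat.eq_zero_or_pos a with rfl | ha
    · rw [zero_add, zero_add, colexPoly_one, add_comm]
    obtain ⟨x, rfl | rfl⟩ := Nat.even_or_odd' a <;> obtain ⟨y, rfl | rfl⟩ := Nat.even_or_odd' b
    · rw [← mul_add, colexPoly_two_mul_add_one, colexPoly_two_mul_add_one,
        colexPoly_two_mul_add_one]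
      nlinarith [ih x (by omega) y, sub x y]
    · rw [show 2 * x + (2 * y + 1) + 1 = 2 * (x + y + 1) by ring,
        show 2 * y + 1 + 1 = 2 * (y + 1) by ring, colexPoly_two_mul, colexPoly_two_mul,
        colexPoly_two_mul_add_one]
      have e := sub x (y + 1)
      rw [← add_assoc] at e
      nlinarith [ih x (by omega) y]
    · rw [show 2 * x + 1 + 2 * y + 1 = 2 * (x + y + 1) by ring,
        show 2 * x + 1 + 1 = 2 * (x + 1) by ring, colexPoly_two_mul, colexPoly_two_mul,
        colexPoly_two_mul_add_one]
      have e := sub (x + 1) y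
      rw [add_right_comm] at e
      nlinarith [ih x (by omega) y]
    · rw [show 2 * x + 1 + (2 * y + 1) + 1 = 2 * (x + y + 1) + 1 by ring,
        show 2 * x + 1 + 1 = 2 * (x + 1) by ring, show 2 * y + 1 + 1 = 2 * (y + 1) by ring,
        colexPoly_two_mul, colexPoly_two_mul, colexPoly_two_mul_add_one,
        colexPoly_succ (x + y + 1)]
      have e : t ^ binaryWeight (x + y + 1) ≤ t := by
        simpa using pow_le_pow_of_le_one h0 h1 (binaryWeight_pos (n := x + y + 1) (by omega))
      nlinarith [ih x (by omega) y]

end colexPoly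

/-! ### Lower sets: deletion, link and size polynomials. -/

section families

variable {V : Type u} [DecidableEq V]

/-- The union of the members of a set family. -/
def support (E : Finset (Finset V)) : Finset V := E.biUnion id

/-- The members of `E` avoiding `v`. -/
def deletion (E : Finset (Finset V)) (v : V) : Finset (Finset V) := E.filter fun e => v ∉ e

/-- The members of `E` containing `v`. -/
def openStar (E : Finset (Finset V)) (v : V) : Finset (Finset V) := E.filter fun e => v ∈ e

/-- The members of `E` containing `v`, with `v` removed. -/
def link (E : Finset (Finset V)) (v : V) : Finset (Finset V) :=
  (openStar E v).image fun e => e.erase v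

/-- The generating polynomial of the sizes of the members of `E`. -/
def sizePoly (t : ℝ) (E : Finset (Finset V)) : ℝ := ∑ e ∈ E, t ^ e.card

variable {E : Finset (Finset V)} {v : V}

theorem mem_openStar {e : Finset V} : e ∈ openStar E v ↔ e ∈ E ∧ v ∈ e := Finset.mem_filter

theorem mem_deletion {e : Finset V} : e ∈ deletion E v ↔ e ∈ E ∧ v ∉ e := Finset.mem_filter

theorem mem_link {f : Finset V} : f ∈ link E v ↔ v ∉ f ∧ insert v f ∈ E := by
  simp only [link, Finset.mem_image, mem_openStar]
  constructor
  · rintro ⟨e, ⟨he, hv⟩, rfl⟩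
    exact ⟨Finset.notMem_erase _ _, by rwa [Finset.insert_erase hv]⟩
  · rintro ⟨hv, he⟩
    exact ⟨insert v f, ⟨he, Finset.mem_insert_self _ _⟩, Finset.erase_insert hv⟩

theorem sum_link {M : Type*} [AddCommMonoid M] (φ : Finset V → M) :
    ∑ f ∈ link E v, φ f = ∑ e ∈ openStar E v, φ (e.erase v) := by
  rw [link, Finset.sum_image]
  intro a ha b hb h
  rw [← Finset.insert_erase (mem_openStar.1 ha).2, ← Finset.insert_erase (mem_openStar.1 hb).2]
  exact congrArg (insert v) h

theorem card_link : (link E v).card = (openStar E v).card := by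
  rw [Finset.card_eq_sum_ones, Finset.card_eq_sum_ones, sum_link]

theorem sum_deletion_add_sum_openStar {M : Type*} [AddCommMonoid M] (φ : Finset V → M) :
    ∑ f ∈ deletion E v, φ f + ∑ f ∈ openStar E v, φ f = ∑ f ∈ E, φ f := by
  rw [add_comm]
  exact Finset.sum_filter_add_sum_filter_not _ _ _

theorem card_deletion_add_card_openStar : (deletion E v).card + (openStar E v).card = E.card := by
  simp only [Finset.card_eq_sum_ones, sum_deletion_add_sum_openStar]

theorem card_deletion_add_card_link : (deletion E v).card + (link E v).card = E.card := by
  rw [card_link, card_deletion_add_card_openStar]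

theorem sizePoly_eq (t : ℝ) (v : V) :
    sizePoly t E = sizePoly t (deletion E v) + t * sizePoly t (link E v) := by
  unfold sizePoly
  rw [← sum_deletion_add_sum_openStar (v := v), sum_link, Finset.mul_sum]
  congr 1
  refine Finset.sum_congr rfl fun e he => ?_
  rw [← Finset.card_erase_add_one (mem_openStar.1 he).2, pow_succ, mul_comm]

theorem IsLowerSet.mem_of_subset (hE : IsLowerSet (E : Set (Finset V))) {e f : Finset V}
    (hf : f ∈ E) (h : e ⊆ f) : e ∈ E := hE h hf

theorem IsLowerSet.isLowerSet_deletion (hE : IsLowerSet (E : Set (Finset V))) (v : V) :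
    IsLowerSet (deletion E v : Set (Finset V)) := by
  intro a b hab ha
  simp only [Finset.mem_coe, mem_deletion] at ha ⊢
  exact ⟨hE hab ha.1, fun h => ha.2 (hab h)⟩

theorem IsLowerSet.isLowerSet_link (hE : IsLowerSet (E : Set (Finset V))) (v : V) :
    IsLowerSet (link E v : Set (Finset V)) := by
  intro a b hab ha
  simp only [Finset.mem_coe, mem_link] at ha ⊢
  exact ⟨fun h => ha.1 (hab h), hE (Finset.insert_subset_insert _ hab) ha.2⟩

theorem IsLowerSet.link_subset_deletion (hE : IsLowerSet (E : Set (Finset V))) (v : V) :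
    link E v ⊆ deletion E v := fun f hf => by
  rw [mem_link] at hf
  exact mem_deletion.2 ⟨hE.mem_of_subset hf.2 (Finset.subset_insert _ _), hf.1⟩

theorem IsLowerSet.mem_support (hE : IsLowerSet (E : Set (Finset V))) :
    v ∈ support E ↔ {v} ∈ E := by
  simp only [support, Finset.mem_biUnion, id]
  constructor
  · rintro ⟨e, he, hv⟩
    exact hE.mem_of_subset he (by simpa using hv)
  · exact fun h => ⟨_, h, Finset.mem_singleton_self _⟩

theorem IsLowerSet.empty_mem (hE : IsLowerSet (E : Set (Finset V))) (h : E.Nonempty) : ∅ ∈ E := by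
  obtain ⟨e, he⟩ := h
  exact hE.mem_of_subset he (Finset.empty_subset _)

theorem IsLowerSet.support_deletion (hE : IsLowerSet (E : Set (Finset V))) (v : V) :
    support (deletion E v) = (support E).erase v := by
  ext z
  rw [(hE.isLowerSet_deletion v).mem_support, Finset.mem_erase, hE.mem_support, mem_deletion,
    Finset.mem_singleton, and_comm, ne_comm]

theorem IsLowerSet.mem_support_link (hE : IsLowerSet (E : Set (Finset V))) {z : V} :
    z ∈ support (link E v) ↔ v ≠ z ∧ {v, z} ∈ E := by
  rw [(hE.isLowerSet_link v).mem_support, mem_link, Finset.mem_singleton]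

theorem subset_support {e : Finset V} (he : e ∈ E) : e ⊆ support E := fun _ hx =>
  Finset.mem_biUnion.2 ⟨e, he, hx⟩

/-- Among the lower sets with a given number of members, the initial segments of the binary order
minimize `∑ t ^ |e|` for `0 ≤ t ≤ 1`. -/
theorem IsLowerSet.colexPoly_le_sizePoly {t : ℝ} (h0 : 0 ≤ t) (h1 : t ≤ 1)
    {E : Finset (Finset V)} (hE : IsLowerSet (E : Set (Finset V))) :
    colexPoly t E.card ≤ sizePoly t E := by
  induction h : E.card using Nat.strong_induction_on generalizing E with
  | _ n ih =>
    subst h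
    rcases (support E).eq_empty_or_nonempty with hs | ⟨v, hv⟩
    · have hsub : E ⊆ {∅} := fun e he => by
        have := subset_support he
        rw [hs, Finset.subset_empty] at this
        simp [this]
      rcases Finset.subset_singleton_iff.1 hsub with h | h
      · simp [h, colexPoly_zero, sizePoly]
      · simp [h, colexPoly_one, sizePoly]
    · have hcard := card_deletion_add_card_link (E := E) (v := v)
      have hle := Finset.card_le_card (hE.link_subset_deletion v)
      have hpos : 0 < (link E v).card := Finset.card_pos.2
        ⟨∅, mem_link.2 ⟨by simp, by simpa using hE.mem_support.1 hv⟩⟩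
      have e1 := ih _ (by omega) (hE.isLowerSet_deletion v) rfl
      have e2 := ih _ (by omega) (hE.isLowerSet_link v) rfl
      rw [sizePoly_eq t v, ← hcard]
      have := colexPoly_add_le h0 h1 _ _ hle
      nlinarith

/-- A lower set that is a cone over each of its vertices is a full power set. -/
theorem IsLowerSet.two_pow_le_card (hE : IsLowerSet (E : Set (Finset V))) (hne : E.Nonempty)
    (h : ∀ v ∈ support E, ∀ f ∈ E, insert v f ∈ E) : 2 ^ (support E).card ≤ E.card := by
  have key : ∀ s ⊆ support E, s ∈ E := by
    intro s
    induction s using Finset.induction_on with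
    | empty => exact fun _ => hE.empty_mem hne
    | insert a s _ ih =>
      intro hs
      rw [Finset.insert_subset_iff] at hs
      exact h a hs.1 s (ih hs.2)
  rw [← Finset.card_powerset]
  exact Finset.card_le_card fun s hs => key s (Finset.mem_powerset.1 hs)

/-- A lower set with more vertices than its size requires has a larger size polynomial. -/
theorem IsLowerSet.colexPoly_add_le_sizePoly {t : ℝ} (h0 : 0 ≤ t) (h1 : t ≤ 1) (n : ℕ)
    {E : Finset (Finset V)} (hE : IsLowerSet (E : Set (Finset V))) {N : ℕ} (hN : E.card = N + 1)
    (hs : n + 1 ≤ (support E).card) (hcard : E.card ≤ 2 ^ n) :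
    colexPoly t N + t ≤ sizePoly t E := by
  have hne : E.Nonempty := Finset.card_pos.1 (by omega)
  induction n generalizing E N with
  | zero =>
    obtain ⟨v, hv⟩ := Finset.card_pos.1 (by omega : 0 < (support E).card)
    have : 1 < E.card := Finset.one_lt_card.2
      ⟨∅, hE.empty_mem hne, {v}, hE.mem_support.1 hv, (Finset.singleton_ne_empty v).symm⟩
    simp at hcard
    omega
  | succ n ih =>
    -- Otherwise `E` would be a full power set, with more than `2^(n+1)` members. For this `v` the
    -- link is strictly smaller than the deletion.
    obtain ⟨v, hv, f, hf, hfv⟩ : ∃ v ∈ support E, ∃ f ∈ E, insert v f ∉ E := by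
      by_contra! hcon
      have h2 := hE.two_pow_le_card hne hcon
      have h3 : 2 ^ (n + 1) < 2 ^ (support E).card :=
        Nat.pow_lt_pow_right (by norm_num) (by omega)
      omega
    have hcard' := card_deletion_add_card_link (E := E) (v := v)
    have hlt : (link E v).card < (deletion E v).card := by
      refine Finset.card_lt_card ((Finset.ssubset_iff_of_subset (hE.link_subset_deletion v)).2
        ⟨f, mem_deletion.2 ⟨hf, fun h => hfv (by rwa [Finset.insert_eq_of_mem h])⟩, fun h => ?_⟩)
      exact hfv (mem_link.1 h).2
    have hpos : 0 < (link E v).card := Finset.card_pos.2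
      ⟨∅, mem_link.2 ⟨by simp, by simpa using hE.mem_support.1 hv⟩⟩
    have e2 := (hE.isLowerSet_link v).colexPoly_le_sizePoly h0 h1
    rw [sizePoly_eq t v]
    obtain ⟨a, ha⟩ : ∃ a, (deletion E v).card = a + 1 := ⟨_, (Nat.succ_pred (by omega)).symm⟩
    -- A small deletion has lost only the vertex `v`, so the induction hypothesis applies to it. A
    -- large one contains a whole block `2^n`, and the remainders are compared by
    -- `colexPoly_add_one_le`.
    rcases le_or_gt (deletion E v).card (2 ^ n) with hle | hgt
    · have e1 := ih (hE.isLowerSet_deletion v) ha (by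
        rw [hE.support_deletion, Finset.card_erase_of_mem hv]; omega) hle
        (Finset.card_pos.1 (by omega))
      have e3 := colexPoly_add_le h0 h1 a (link E v).card (by omega)
      rw [show N = a + (link E v).card by omega]
      nlinarith
    · have e1 := (hE.isLowerSet_deletion v).colexPoly_le_sizePoly h0 h1
      obtain ⟨c, hc⟩ : ∃ c, (deletion E v).card = 2 ^ n + (c + 1) :=
        ⟨(deletion E v).card - 2 ^ n - 1, by omega⟩
      obtain ⟨b, hb⟩ : ∃ b, (link E v).card = b + 1 := ⟨_, (Nat.succ_pred (by omega)).symm⟩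
      rw [pow_succ] at hcard
      rw [hc, colexPoly_two_pow_add _ _ (by omega)] at e1
      rw [hb] at e2
      rw [show N = 2 ^ n + (c + b + 1) by omega, colexPoly_two_pow_add _ _ (by omega)]
      have := colexPoly_add_one_le h0 h1 c b
      nlinarith

/-! ### Weights of links, by integration over `[0,1]`. -/

/-- The sum of `1 / (|f| + 1)` over a family. -/
noncomputable def coneWeight (E : Finset (Finset V)) : ℝ := ∑ f ∈ E, 1 / ((f.card : ℝ) + 1)

theorem coneWeight_eq_integral : coneWeight E = ∫ t in (0 : ℝ)..1, sizePoly t E := by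
  unfold sizePoly coneWeight
  rw [intervalIntegral.integral_finsetSum]
  · refine Finset.sum_congr rfl fun f _ => ?_
    simp [integral_pow]
  · intro i _
    exact (continuous_pow _).intervalIntegrable _ _

theorem integral_colexPoly (N : ℕ) : ∫ t in (0 : ℝ)..1, colexPoly t N =
    ∑ i ∈ Finset.range N, 1 / ((binaryWeight i : ℝ) + 1) := by
  unfold colexPoly
  rw [intervalIntegral.integral_finsetSum]
  · refine Finset.sum_congr rfl fun f _ => ?_
    simp [integral_pow]
  · intro i _
    exact (continuous_pow _).intervalIntegrable _ _

theorem continuous_sizePoly : Continuous fun t => sizePoly t E := by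
  unfold sizePoly
  fun_prop

theorem continuous_colexPoly (N : ℕ) : Continuous fun t => colexPoly t N := by
  unfold colexPoly
  fun_prop

theorem sum_binaryWeight_two_pow (d : ℕ) : ∑ i ∈ Finset.range (2 ^ d),
    1 / ((binaryWeight i : ℝ) + 1) = ((2 : ℝ) ^ (d + 1) - 1) / (d + 1) := by
  rw [← integral_colexPoly]
  simp only [colexPoly_two_pow]
  have := intervalIntegral.integral_comp_add_left (a := 0) (b := 1) (fun x : ℝ => x ^ d) 1
  rw [this, integral_pow]
  norm_num

/-- The last `m` numbers below `2^d` are the digit complements of the first `m`. -/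
theorem sum_binaryWeight_two_pow_sub {d m : ℕ} (hm : m ≤ 2 ^ d) :
    ∑ i ∈ Finset.range (2 ^ d - m), 1 / ((binaryWeight i : ℝ) + 1) =
      ((2 : ℝ) ^ (d + 1) - 1) / (d + 1) -
        ∑ i ∈ Finset.range m, 1 / ((d : ℝ) + 1 - binaryWeight i) := by
  rw [← sum_binaryWeight_two_pow, eq_sub_iff_add_eq]
  conv_rhs => rw [← Nat.sub_add_cancel hm, Finset.sum_range_add]
  congr 1
  rw [← Finset.sum_range_reflect]
  refine Finset.sum_congr rfl fun i hi => ?_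
  have hi := Finset.mem_range.1 hi
  have e := binaryWeight_complement d (m - 1 - i) (by omega)
  rw [show 2 ^ d - 1 - (m - 1 - i) = 2 ^ d - m + i by omega] at e
  have e' : (d : ℝ) = binaryWeight (2 ^ d - m + i) + binaryWeight (m - 1 - i) := by
    exact_mod_cast e.symm
  rw [e']
  congr 1
  ring

theorem IsLowerSet.sum_binaryWeight_le_coneWeight (hE : IsLowerSet (E : Set (Finset V))) {N : ℕ}
    (hN : N ≤ E.card) :
    ∑ i ∈ Finset.range N, 1 / ((binaryWeight i : ℝ) + 1) ≤ coneWeight E := by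
  rw [coneWeight_eq_integral, ← integral_colexPoly]
  refine intervalIntegral.integral_mono_on zero_le_one
    ((continuous_colexPoly _).intervalIntegrable _ _)
    (continuous_sizePoly.intervalIntegrable _ _) fun t ht => ?_
  exact (colexPoly_mono ht.1 hN).trans (hE.colexPoly_le_sizePoly ht.1 ht.2)

theorem IsLowerSet.half_add_sum_binaryWeight_le_coneWeight (hE : IsLowerSet (E : Set (Finset V)))
    {n N : ℕ} (hN : N + 1 ≤ E.card) (hs : n + 1 ≤ (support E).card) (hcard : E.card ≤ 2 ^ n) :
    1 / 2 + ∑ i ∈ Finset.range N, 1 / ((binaryWeight i : ℝ) + 1) ≤ coneWeight E := by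
  obtain ⟨M, hM⟩ : ∃ M, E.card = M + 1 := ⟨_, (Nat.succ_pred (by omega)).symm⟩
  have h : ∫ t in (0 : ℝ)..1, (colexPoly t N + t) =
      1 / 2 + ∑ i ∈ Finset.range N, 1 / ((binaryWeight i : ℝ) + 1) := by
    rw [intervalIntegral.integral_add ((continuous_colexPoly _).intervalIntegrable _ _)
      (continuous_id'.intervalIntegrable _ _), integral_colexPoly, add_comm]
    simp
  rw [coneWeight_eq_integral, ← h]
  refine intervalIntegral.integral_mono_on zero_le_one
    (((continuous_colexPoly _).add continuous_id').intervalIntegrable _ _)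
    (continuous_sizePoly.intervalIntegrable _ _) fun t ht => ?_
  have := colexPoly_mono ht.1 (show N ≤ M by omega)
  linarith [hE.colexPoly_add_le_sizePoly ht.1 ht.2 n hM hs hcard]

/-- The constant of the main theorem. -/
noncomputable def alphaValue (d m : ℕ) : ℝ := ((2 : ℝ) ^ (d + 1) - m) / (d + 1)

/-- A link lacks at most `m - 1 ≤ 1` sets of a `d`-cube, and the top set costs exactly `1/(d+1)`. A
second set would already cost `1/d`, which is why larger `m` needs redistribution. -/
theorem IsLowerSet.alphaValue_le_coneWeight_of_le_two (hE : IsLowerSet (E : Set (Finset V)))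
    {d m : ℕ} (h1 : 1 ≤ m) (h2 : m ≤ 2) (hcard : 2 ^ d - m + 1 ≤ E.card) (hmd : m ≤ 2 ^ d) :
    alphaValue d m ≤ coneWeight E := by
  refine le_trans ?_ (hE.sum_binaryWeight_le_coneWeight
    (show 2 ^ d - (m - 1) ≤ E.card by omega))
  rw [sum_binaryWeight_two_pow_sub (by omega), alphaValue]
  obtain rfl | rfl : m = 1 ∨ m = 2 := by omega
  · simp
  · simp only [Nat.add_one_sub_one, Finset.sum_range_one, binaryWeight_zero]
    rw [← sub_nonneg]
    apply le_of_eq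
    push_cast
    ring

theorem three_mul_le_of_two_pow_le {s d : ℕ} (h : 2 ^ s ≤ d) (hd : 5 ≤ d) : 3 * s ≤ d + 1 := by
  rcases lt_or_ge s 3 with hs | hs
  · omega
  · have : ∀ s, 3 ≤ s → 3 * s ≤ 2 ^ s + 1 := by
      intro s hs
      induction s, hs using Nat.le_induction with
      | base => norm_num
      | succ k hk ih => rw [pow_succ]; omega
    have := this s hs
    omega

theorem sum_one_div_sub_binaryWeight_le {d m : ℕ} (hd : 4 ≤ d) (h1 : 1 ≤ m) (hm : m ≤ d) :
    ∑ i ∈ Finset.range m, 1 / ((d : ℝ) + 1 - binaryWeight i) ≤ 1 / 2 + ((m : ℝ) - 1) / (d + 1) := by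
  -- For `d = 4` the estimate `3 * s ≤ d + 1` fails at `s = 2`, so the values of `m` are checked one
  -- by one.
  rcases hd.eq_or_lt with rfl | hd
  · have w1 : binaryWeight 1 = 1 := by simp [binaryWeight]
    have w2 : binaryWeight 2 = 1 := by simp [binaryWeight]
    have w3 : binaryWeight 3 = 2 := by simp [binaryWeight]
    interval_cases m <;> norm_num [Finset.sum_range_succ, binaryWeight_zero, w1, w2, w3]
  · obtain ⟨k, rfl⟩ : ∃ k, m = k + 1 := ⟨m - 1, by omega⟩
    have hd0 : (0 : ℝ) < (d : ℝ) + 1 := by positivity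
    have hle : ∀ i ∈ Finset.range k, 1 / ((d : ℝ) + 1 - binaryWeight (i + 1)) ≤
        3 / 2 / ((d : ℝ) + 1) := by
      intro i hi
      have hi := Finset.mem_range.1 hi
      have h2 := two_pow_binaryWeight_le (i + 1)
      have h3 : (3 * binaryWeight (i + 1) : ℝ) ≤ d + 1 := by
        exact_mod_cast three_mul_le_of_two_pow_le (h2.trans (by omega)) hd
      rw [div_le_div_iff₀ (by linarith) hd0]
      linarith
    rw [Finset.sum_range_succ', binaryWeight_zero]
    have := Finset.sum_le_sum hle
    rw [Finset.sum_const, Finset.card_range, nsmul_eq_mul] at this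
    have hk : (k : ℝ) + 1 ≤ d := by exact_mod_cast hm
    have e : (k : ℝ) * (3 / 2 / (d + 1)) + 1 / (d + 1 - (0 : ℕ)) ≤
        1 / 2 + (((k + 1 : ℕ) : ℝ) - 1) / (d + 1) := by
      push_cast
      rw [sub_zero, add_sub_cancel_right, ← sub_nonneg]
      have : (1 / 2 + (k : ℝ) / (d + 1) - (k * (3 / 2 / (d + 1)) + 1 / (d + 1))) =
          ((d : ℝ) - 1 - k) / 2 / (d + 1) := by
        field_simp
        ring
      rw [this]
      exact div_nonneg (by linarith) hd0.le
    linarith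

/-- With at most `2^d` members, the surplus vertex forces an extra singleton of weight `1/2` on top
of `2^d - m` sets, which outweighs the missing top sets. With more members a full cube is already
enough. -/
theorem IsLowerSet.alphaValue_le_coneWeight_of_support (hE : IsLowerSet (E : Set (Finset V)))
    {d m : ℕ} (hd : 4 ≤ d) (h1 : 1 ≤ m) (hm : m ≤ d) (hcard : 2 ^ d - m + 1 ≤ E.card)
    (hs : d + 1 ≤ (support E).card) : alphaValue d m ≤ coneWeight E := by
  have hmd : m ≤ 2 ^ d := hm.trans Nat.lt_two_pow_self.le
  have h1' : (1 : ℝ) ≤ m := by exact_mod_cast h1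
  rcases le_or_gt E.card (2 ^ d) with h | h
  · have := hE.half_add_sum_binaryWeight_le_coneWeight hcard hs h
    rw [sum_binaryWeight_two_pow_sub hmd] at this
    have e := sum_one_div_sub_binaryWeight_le hd h1 hm
    have : alphaValue d m = ((2 : ℝ) ^ (d + 1) - 1) / (d + 1) - ((m : ℝ) - 1) / (d + 1) := by
      rw [alphaValue]; ring
    linarith
  · have := hE.sum_binaryWeight_le_coneWeight h.le
    rw [sum_binaryWeight_two_pow] at this
    refine le_trans ?_ this
    rw [alphaValue]
    gcongr

end families

/-! ### Counting in the family of missing complements. -/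

section missing

variable {V : Type u} [DecidableEq V] {C : Finset (Finset V)}

/-- The members with at least two elements. -/
def bigMembers (C : Finset (Finset V)) : Finset (Finset V) := C.filter fun c => 2 ≤ c.card

theorem mem_bigMembers {c : Finset V} : c ∈ bigMembers C ↔ c ∈ C ∧ 2 ≤ c.card :=
  Finset.mem_filter

theorem IsLowerSet.sum_eq_add {M : Type*} [AddCommMonoid M] (φ : Finset V → M)
    (hC : IsLowerSet (C : Set (Finset V))) (hne : C.Nonempty) :
    ∑ c ∈ C, φ c = φ ∅ + (∑ a ∈ support C, φ {a} + ∑ c ∈ bigMembers C, φ c) := by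
  have h : C = insert ∅ ((support C).image singleton ∪ bigMembers C) := by
    ext c
    simp only [Finset.mem_insert, Finset.mem_union, Finset.mem_image, mem_bigMembers]
    constructor
    · intro hc
      rcases Nat.lt_or_ge c.card 2 with h | h
      · rcases (by omega : c.card = 0 ∨ c.card = 1) with h | h
        · exact Or.inl (Finset.card_eq_zero.1 h)
        · obtain ⟨a, rfl⟩ := Finset.card_eq_one.1 h
          exact Or.inr (Or.inl ⟨a, hC.mem_support.2 hc, rfl⟩)
      · exact Or.inr (Or.inr ⟨hc, h⟩)
    · rintro (rfl | ⟨a, ha, rfl⟩ | ⟨hc, -⟩)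
      · exact hC.empty_mem hne
      · exact hC.mem_support.1 ha
      · exact hc
  conv_lhs => rw [h]
  rw [Finset.sum_insert, Finset.sum_union,
    Finset.sum_image Finset.singleton_injective.injOn]
  · rw [Finset.disjoint_left]
    intro c hc hc'
    obtain ⟨a, -, rfl⟩ := Finset.mem_image.1 hc
    simp [mem_bigMembers] at hc'
  · simp [mem_bigMembers]

theorem IsLowerSet.card_eq_one_add (hC : IsLowerSet (C : Set (Finset V))) (hne : C.Nonempty) :
    C.card = 1 + (support C).card + (bigMembers C).card := by
  simp only [Finset.card_eq_sum_ones]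
  rw [hC.sum_eq_add _ hne, add_assoc]

theorem IsLowerSet.card_openStar_eq (hC : IsLowerSet (C : Set (Finset V))) {x : V}
    (hx : x ∈ support C) : (openStar C x).card = 1 + (openStar (bigMembers C) x).card := by
  have h : openStar C x = insert {x} (openStar (bigMembers C) x) := by
    ext c
    simp only [Finset.mem_insert, mem_openStar, mem_bigMembers]
    constructor
    · rintro ⟨hc, hxc⟩
      rcases Nat.lt_or_ge c.card 2 with h | h
      · have : c.card = 1 := by
          have := Finset.card_pos.2 ⟨x, hxc⟩
          omega
        obtain ⟨a, rfl⟩ := Finset.card_eq_one.1 this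
        rw [Finset.mem_singleton.1 hxc]
        exact Or.inl rfl
      · exact Or.inr ⟨⟨hc, h⟩, hxc⟩
    · rintro (rfl | ⟨⟨hc, -⟩, hxc⟩)
      · exact ⟨hC.mem_support.1 hx, Finset.mem_singleton_self _⟩
      · exact ⟨hc, hxc⟩
  rw [h, Finset.card_insert_of_notMem, add_comm]
  simp [mem_openStar, mem_bigMembers]

theorem IsLowerSet.card_bigMembers_eq (hC : IsLowerSet (C : Set (Finset V))) {x : V}
    (hx : x ∈ support C) :
    (bigMembers C).card + 1 = (openStar C x).card + (bigMembers (link C x)).card +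
      (bigMembers (deletion C x \ link C x)).card := by
  have h1 := card_deletion_add_card_openStar (E := bigMembers C) (v := x)
  have h2 : deletion (bigMembers C) x =
      bigMembers (link C x) ∪ bigMembers (deletion C x \ link C x) := by
    ext c
    have := @hC.link_subset_deletion _ _ C x c
    simp only [mem_deletion, Finset.mem_union, mem_bigMembers, Finset.mem_sdiff] at this ⊢
    tauto
  have h3 : Disjoint (bigMembers (link C x)) (bigMembers (deletion C x \ link C x)) := by
    rw [Finset.disjoint_left]
    intro c hc hc'
    exact (Finset.mem_sdiff.1 (mem_bigMembers.1 hc').1).2 (mem_bigMembers.1 hc).1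
  rw [h2, Finset.card_union_of_disjoint h3] at h1
  have h4 := hC.card_openStar_eq hx
  omega

/-- A member through `x'` either contains `x`, or lies in the link of `x`, or is a big member of
deletion minus link. The first two kinds are each bounded by the star of `x'` in the link. -/
theorem IsLowerSet.card_openStar_le (hC : IsLowerSet (C : Set (Finset V))) {x x' : V}
    (hx' : x' ∈ support (link C x)) :
    (openStar C x').card ≤ 2 + 2 * (bigMembers (link C x)).card +
      (bigMembers (deletion C x \ link C x)).card := by
  have hne : x ≠ x' := (hC.mem_support_link.1 hx').1
  have hK := (hC.isLowerSet_link x).card_openStar_eq hx'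
  have hle : (openStar (bigMembers (link C x)) x').card ≤ (bigMembers (link C x)).card :=
    Finset.card_filter_le _ _
  have hsub : openStar C x' ⊆ (openStar (link C x) x').image (insert x) ∪
      (openStar (link C x) x' ∪ bigMembers (deletion C x \ link C x)) := by
    intro c hc
    obtain ⟨hc, hxc'⟩ := mem_openStar.1 hc
    simp only [Finset.mem_union, Finset.mem_image]
    by_cases hxc : x ∈ c
    · refine Or.inl ⟨c.erase x, mem_openStar.2 ⟨mem_link.2 ⟨Finset.notMem_erase _ _, ?_⟩, ?_⟩,
        Finset.insert_erase hxc⟩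
      · rwa [Finset.insert_erase hxc]
      · exact Finset.mem_erase.2 ⟨hne.symm, hxc'⟩
    · right
      by_cases hcK : c ∈ link C x
      · exact Or.inl (mem_openStar.2 ⟨hcK, hxc'⟩)
      · refine Or.inr (mem_bigMembers.2 ⟨Finset.mem_sdiff.2 ⟨mem_deletion.2 ⟨hc, hxc⟩, hcK⟩, ?_⟩)
        by_contra hlt
        have : c.card = 1 := by
          have := Finset.card_pos.2 ⟨x', hxc'⟩
          omega
        obtain ⟨a, rfl⟩ := Finset.card_eq_one.1 this
        rw [Finset.mem_singleton] at hxc'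
        subst hxc'
        exact hcK ((hC.isLowerSet_link x).mem_support.1 hx')
  have h1 := Finset.card_le_card hsub
  have h2 := Finset.card_union_le ((openStar (link C x) x').image (insert x))
    (openStar (link C x) x' ∪ bigMembers (deletion C x \ link C x))
  have h3 := Finset.card_union_le (openStar (link C x) x') (bigMembers (deletion C x \ link C x))
  have h4 : ((openStar (link C x) x').image (insert x)).card ≤ _ := Finset.card_image_le
  omega

/-- The contribution required from a vertex lying in no missing complement. -/
noncomputable def cap : ℕ → ℝ
  | 0 => 0
  | 1 => 1 / 2
  | 2 => 3 / 4
  | 3 => 1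
  | 4 => 4 / 3
  | 5 => 3 / 2
  | 6 => 7 / 4
  | _ => 2

theorem cap_of_seven_le {g : ℕ} (h : 7 ≤ g) : cap g = 2 := by
  obtain ⟨k, rfl⟩ := Nat.exists_eq_add_of_le' h
  rfl

theorem cap_nonneg (g : ℕ) : 0 ≤ cap g := by
  rcases lt_or_ge g 7 with h | h
  · interval_cases g <;> norm_num [cap]
  · rw [cap_of_seven_le h]; norm_num

theorem half_le_cap {g : ℕ} (hg : 1 ≤ g) : 1 / 2 ≤ cap g := by
  rcases lt_or_ge g 7 with h | h
  · interval_cases g <;> norm_num [cap]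
  · rw [cap_of_seven_le h]; norm_num

/-- Here `C` is the family of missing complements of a class `A`, `B` its set of tight vertices, `g`
the excess and `ε` the transfers. Every big member of `C` uses up part of the bound on `|C|`, so few
vertices are covered by `C`, and each uncovered vertex contributes `cap g`. The values of `cap` are
small enough to be available on leaving edges and large enough for this count. -/
theorem le_sum_of_card_missing {A B : Finset V} {d m g : ℕ} {ε : V → ℝ}
    (hC : IsLowerSet (C : Set (Finset V))) (hCA : ∀ c ∈ C, c ⊆ A) (hA : A.card = d + 1)
    (hd : 4 ≤ d) (hmd : m ≤ d) (hcard : C.card + 1 = m + g) (hg : 1 ≤ g)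
    (hBne : B.Nonempty) (hB : ∀ x ∈ B, g ≤ (openStar C x).card)
    (h1 : ∀ y ∈ A \ B, 1 / 2 ≤ ε y)
    (h2 : ∀ y ∈ A \ B, y ∉ support C → cap g ≤ ε y)
    (h3 : 7 ≤ g → ∀ y ∈ A \ B, (openStar C y).card + 3 ≤ g → 1 ≤ ε y) :
    (g : ℝ) ≤ ∑ y ∈ A \ B, ε y := by
  have hsA : support C ⊆ A := by
    intro z hz
    exact hCA _ (hC.mem_support.1 hz) (Finset.mem_singleton_self _)
  have hBs : B ⊆ support C := by
    intro x hx
    obtain ⟨c, hc⟩ := Finset.card_pos.1 (hg.trans (hB x hx))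
    exact subset_support (mem_openStar.1 hc).1 (mem_openStar.1 hc).2
  obtain ⟨x, hx⟩ := hBne
  have hxs := hBs hx
  have hCne : C.Nonempty := ⟨_, hC.mem_support.1 hxs⟩
  have hKne : (link C x).Nonempty :=
    ⟨∅, mem_link.2 ⟨by simp, by simpa using hC.mem_support.1 hxs⟩⟩
  have e1 := hC.card_eq_one_add hCne
  have e2 := (hC.isLowerSet_link x).card_eq_one_add hKne
  have e3 := hC.card_bigMembers_eq hxs
  have e4 := hB x hx
  rw [card_link] at e2
  have e5 : (A \ support C).card + (support C).card = d + 1 := by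
    rw [← hA]; exact Finset.card_sdiff_add_card_eq_card hsA
  set Y := A \ support C with hY
  set r := (bigMembers (link C x)).card with hr
  set o := (bigMembers (deletion C x \ link C x)).card with ho
  set v := (support (link C x)).card with hv
  set g' := (openStar C x).card with hg'
  -- Compare `|C| = m + g - 1 ≤ d + g - 1` with `|C| = (d + 1 - |Y|) + g' + r + o`.
  have hYle : 2 + (r + o + (g' - g)) ≤ Y.card := by omega
  set R := r + o + (g' - g) with hR
  have hvR : g ≤ v + R + 1 := by omega
  have hYN : Y ⊆ A \ B := Finset.sdiff_subset_sdiff le_rfl hBs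
  have hεnn : ∀ y ∈ A \ B, 0 ≤ ε y := fun y hy => by linarith [h1 y hy]
  have hYsum : (Y.card : ℝ) * cap g ≤ ∑ y ∈ Y, ε y := by
    rw [← nsmul_eq_mul, ← Finset.sum_const]
    exact Finset.sum_le_sum fun y hy => h2 y (hYN hy) (Finset.mem_sdiff.1 hy).2
  have hYR : (2 : ℝ) + R ≤ Y.card := by exact_mod_cast hYle
  have hR0 : (0 : ℝ) ≤ R := by positivity
  by_cases hcase : ∃ x' ∈ support (link C x), x' ∈ B
  · obtain ⟨x', hx', hx'B⟩ := hcase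
    have e6 := hC.card_openStar_le hx'
    have e7 := hB x' hx'B
    have e8 : g ≤ 2 + 2 * R := by omega
    -- This is the only case in which `(2 + R) * cap g` can be below `g`; a third uncovered vertex,
    -- or a vertex covered only by its singleton, supplies the missing `1/2`.
    by_cases hspecial : g = 2 ∧ R = 0
    · obtain ⟨hg2, hR00⟩ := hspecial
      -- only one big member, so some vertex of `C` outside `{x, x'}` is not in `B`
      rcases lt_or_ge 2 Y.card with hY3 | hY2
      · have : (3 : ℝ) ≤ Y.card := by exact_mod_cast hY3
        have hle : ∑ y ∈ Y, ε y ≤ ∑ y ∈ A \ B, ε y :=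
          Finset.sum_le_sum_of_subset_of_nonneg hYN fun y hy _ => hεnn y hy
        rw [hg2] at hYsum ⊢
        norm_num [cap] at hYsum ⊢
        linarith
      · have hs3 : 2 < (support C).card := by omega
        obtain ⟨z, hz, hzx, hzx'⟩ : ∃ z ∈ support C, z ≠ x ∧ z ≠ x' := by
          by_contra! hcon
          have : support C ⊆ {x, x'} := by
            intro z hz
            by_cases h : z = x
            · simp [h]
            · simp [hcon z hz h]
          have := Finset.card_le_card this
          have := Finset.card_le_two (a := x) (b := x')
          omega
        have hbig : (bigMembers C).card = 1 := by omega
        obtain ⟨c, hc⟩ := Finset.card_eq_one.1 hbig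
        have hpair : ({x, x'} : Finset V) ∈ bigMembers C := by
          have := hC.mem_support_link.1 hx'
          exact mem_bigMembers.2 ⟨this.2, by rw [Finset.card_pair this.1]⟩
        have hzB : z ∉ B := by
          intro hzB
          have h5 := hB z hzB
          rw [hC.card_openStar_eq hz] at h5
          obtain ⟨c', hc'⟩ := Finset.card_pos.1
            (by omega : 0 < (openStar (bigMembers C) z).card)
          obtain ⟨hc'1, hzc'⟩ := mem_openStar.1 hc'
          rw [hc, Finset.mem_singleton] at hc'1 hpair
          rw [hc'1, ← hpair] at hzc'
          simp [hzx, hzx'] at hzc'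
        have hzN : z ∈ A \ B := Finset.mem_sdiff.2 ⟨hsA hz, hzB⟩
        have hzY : z ∉ Y := fun h => (Finset.mem_sdiff.1 h).2 hz
        have hle : ∑ y ∈ insert z Y, ε y ≤ ∑ y ∈ A \ B, ε y :=
          Finset.sum_le_sum_of_subset_of_nonneg (Finset.insert_subset hzN hYN)
            fun y hy _ => hεnn y hy
        rw [Finset.sum_insert hzY] at hle
        have := h1 z hzN
        rw [hg2] at hYsum ⊢
        norm_num [cap] at hYsum ⊢
        linarith
    · have hle : ∑ y ∈ Y, ε y ≤ ∑ y ∈ A \ B, ε y :=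
        Finset.sum_le_sum_of_subset_of_nonneg hYN fun y hy _ => hεnn y hy
      refine le_trans ?_ (hYsum.trans hle)
      refine le_trans ?_ (mul_le_mul_of_nonneg_right hYR (cap_nonneg g))
      rcases lt_or_ge g 7 with h7 | h7
      · interval_cases g
        · norm_num [cap]; linarith
        · have : (1 : ℝ) ≤ R := by exact_mod_cast (by omega : 1 ≤ R)
          norm_num [cap]
          linarith
        · have : (1 : ℝ) ≤ R := by exact_mod_cast (by omega : 1 ≤ R)
          norm_num [cap]
          linarith
        · have : (1 : ℝ) ≤ R := by exact_mod_cast (by omega : 1 ≤ R)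
          norm_num [cap]
          linarith
        · have : (2 : ℝ) ≤ R := by exact_mod_cast (by omega : 2 ≤ R)
          norm_num [cap]
          linarith
        · have : (2 : ℝ) ≤ R := by exact_mod_cast (by omega : 2 ≤ R)
          norm_num [cap]
          linarith
      · have e9 : (g : ℝ) ≤ 2 + 2 * R := by exact_mod_cast e8
        rw [cap_of_seven_le h7]
        linarith
  · push Not at hcase
    have hKC : support (link C x) ⊆ support C := fun z hz =>
      hC.mem_support.2 (hC.mem_of_subset (hC.mem_support_link.1 hz).2 (by simp))
    have hKN : support (link C x) ⊆ A \ B := fun z hz =>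
      Finset.mem_sdiff.2 ⟨hsA (hKC hz), hcase z hz⟩
    have hdisj : Disjoint Y (support (link C x)) :=
      Finset.disjoint_left.2 fun z hz hz' => (Finset.mem_sdiff.1 hz).2 (hKC hz')
    have hle : ∑ y ∈ Y ∪ support (link C x), ε y ≤ ∑ y ∈ A \ B, ε y :=
      Finset.sum_le_sum_of_subset_of_nonneg (Finset.union_subset hYN hKN) fun y hy _ => hεnn y hy
    rw [Finset.sum_union hdisj] at hle
    refine le_trans ?_ hle
    have hvR' : (g : ℝ) ≤ v + R + 1 := by exact_mod_cast hvR
    -- No vertex of the link is in `B`, so all `v` of them contribute as well, each at least `1/2`.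
    -- For `g ≥ 7` they contribute 1 each if `R` is small; if `R` is large, `Y` suffices alone.
    rcases lt_or_ge g 7 with h7 | h7
    · have hK : (v : ℝ) * (1 / 2) ≤ ∑ y ∈ support (link C x), ε y := by
        rw [← nsmul_eq_mul, ← Finset.sum_const]
        exact Finset.sum_le_sum fun y hy => h1 y (hKN hy)
      have := mul_le_mul_of_nonneg_right hYR (cap_nonneg g)
      have := mul_le_mul_of_nonneg_left (half_le_cap hg) hR0
      have : ((g : ℝ) + 1) / 4 ≤ cap g := by
        interval_cases g <;> norm_num [cap]
      linarith
    · by_cases hlarge : 2 + 2 * R + 3 ≤ g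
      · have hK : (v : ℝ) * 1 ≤ ∑ y ∈ support (link C x), ε y := by
          rw [← nsmul_eq_mul, ← Finset.sum_const]
          refine Finset.sum_le_sum fun y hy => h3 h7 y (hKN hy) ?_
          have := hC.card_openStar_le hy
          omega
        rw [cap_of_seven_le h7] at hYsum
        linarith
      · have hKnn : 0 ≤ ∑ y ∈ support (link C x), ε y :=
          Finset.sum_nonneg fun y hy => hεnn y (hKN hy)
        have : (g : ℝ) ≤ 2 * R + 4 := by exact_mod_cast (by omega : g ≤ 2 * R + 4)
        rw [cap_of_seven_le h7] at hYsum
        linarith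

end missing

/-! ### Face weights, and edges inside or leaving a vertex set. -/

section weights

variable {V : Type u} [DecidableEq V] {E F : Finset (Finset V)} {A : Finset V} {x y : V}

/-- The sum of `1 / |e|` over a family. -/
noncomputable def faceWeight (F : Finset (Finset V)) : ℝ := ∑ e ∈ F, 1 / (e.card : ℝ)

/-- The members of `E` contained in `A`. -/
def restriction (E : Finset (Finset V)) (A : Finset V) : Finset (Finset V) :=
  E.filter fun e => e ⊆ A

/-- The members of `E` containing `y` but not contained in `A`. -/
def leaving (E : Finset (Finset V)) (A : Finset V) (y : V) : Finset (Finset V) :=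
  (openStar E y).filter fun e => ¬ e ⊆ A

/-- The complements in `A` of the subsets of `A` that are not in `E`. -/
def missing (E : Finset (Finset V)) (A : Finset V) : Finset (Finset V) :=
  A.powerset.filter fun c => A \ c ∉ E

theorem mem_restriction {e : Finset V} : e ∈ restriction E A ↔ e ∈ E ∧ e ⊆ A :=
  Finset.mem_filter

theorem mem_leaving {e : Finset V} : e ∈ leaving E A y ↔ (e ∈ E ∧ y ∈ e) ∧ ¬ e ⊆ A := by
  rw [leaving, Finset.mem_filter, mem_openStar]

theorem mem_missing {c : Finset V} : c ∈ missing E A ↔ c ⊆ A ∧ A \ c ∉ E := by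
  rw [missing, Finset.mem_filter, Finset.mem_powerset]

theorem faceWeight_mono {F G : Finset (Finset V)} (h : F ⊆ G) : faceWeight F ≤ faceWeight G :=
  Finset.sum_le_sum_of_subset_of_nonneg h fun _ _ _ => by positivity

theorem faceWeight_nonneg : 0 ≤ faceWeight F := Finset.sum_nonneg fun _ _ => by positivity

theorem faceWeight_openStar : faceWeight (openStar E x) = coneWeight (link E x) := by
  rw [coneWeight, sum_link, faceWeight]
  refine Finset.sum_congr rfl fun e he => ?_
  rw [← Finset.card_erase_add_one (mem_openStar.1 he).2]
  push_cast
  rfl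

/-- Double counting: each non-empty `e` gives `1/|e|` to each of its `|e|` vertices. -/
theorem sum_faceWeight_openStar (hF : ∀ e ∈ F, e ⊆ A) :
    ∑ x ∈ A, faceWeight (openStar F x) = ((F.erase ∅).card : ℝ) := by
  simp only [faceWeight, openStar, Finset.sum_filter]
  rw [Finset.sum_comm]
  have : ∀ e ∈ F, ∑ x ∈ A, (if x ∈ e then 1 / (e.card : ℝ) else 0) = if e = ∅ then 0 else 1 := by
    intro e he
    rw [← Finset.sum_filter, Finset.filter_mem_eq_inter, Finset.inter_eq_right.2 (hF e he),
      Finset.sum_const, nsmul_eq_mul]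
    split_ifs with h
    · simp [h]
    · have : (e.card : ℝ) ≠ 0 := by
        exact_mod_cast fun h' => h (Finset.card_eq_zero.1 h')
      field_simp
  rw [Finset.sum_congr rfl this, Finset.sum_ite, Finset.sum_const_zero, zero_add,
    Finset.sum_const, nsmul_eq_mul, mul_one, Finset.filter_ne']

theorem openStar_restriction_union_leaving :
    openStar (restriction E A) y ∪ leaving E A y = openStar E y := by
  ext e
  simp only [Finset.mem_union, mem_openStar, mem_restriction, mem_leaving]
  tauto

theorem disjoint_restriction_leaving :
    Disjoint (openStar (restriction E A) y) (leaving E A y) := by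
  rw [Finset.disjoint_left]
  intro e h1 h2
  exact (mem_leaving.1 h2).2 (mem_restriction.1 (mem_openStar.1 h1).1).2

theorem faceWeight_restriction_add_leaving :
    faceWeight (openStar (restriction E A) y) + faceWeight (leaving E A y) =
      faceWeight (openStar E y) := by
  have := Finset.sum_union (f := fun e => 1 / (e.card : ℝ))
    (disjoint_restriction_leaving (E := E) (A := A) (y := y))
  rw [openStar_restriction_union_leaving] at this
  exact this.symm

theorem card_restriction_add_leaving :
    (openStar (restriction E A) y).card + (leaving E A y).card = (openStar E y).card := by
  have := Finset.card_union_of_disjoint (disjoint_restriction_leaving (E := E) (A := A) (y := y))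
  rw [openStar_restriction_union_leaving] at this
  exact this.symm

theorem IsLowerSet.isLowerSet_missing (hE : IsLowerSet (E : Set (Finset V))) (A : Finset V) :
    IsLowerSet (missing E A : Set (Finset V)) := by
  intro a b hab ha
  simp only [Finset.mem_coe, mem_missing] at ha ⊢
  exact ⟨hab.trans ha.1,
    fun h => ha.2 (hE.mem_of_subset h (Finset.sdiff_subset_sdiff le_rfl hab))⟩

/-- Complementation in `A` turns sums over missing complements into sums over missing sets. -/
theorem sum_missing_filter {M : Type*} [AddCommMonoid M] (φ : Finset V → M)
    (P : Finset V → Prop) [DecidablePred P] :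
    ∑ c ∈ (missing E A).filter fun c => P (A \ c), φ (A \ c) =
      ∑ u ∈ A.powerset.filter fun u => u ∉ E ∧ P u, φ u := by
  refine Finset.sum_bij' (fun c _ => A \ c) (fun u _ => A \ u) ?_ ?_ ?_ ?_ ?_
  · intro c hc
    simp only [Finset.mem_filter, mem_missing, Finset.mem_powerset] at hc ⊢
    exact ⟨Finset.sdiff_subset, hc.1.2, hc.2⟩
  · intro u hu
    simp only [Finset.mem_filter, mem_missing, Finset.mem_powerset] at hu ⊢
    rw [Finset.sdiff_sdiff_eq_self hu.1]
    exact ⟨⟨Finset.sdiff_subset, hu.2.1⟩, hu.2.2⟩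
  · intro c hc
    simp only [Finset.mem_filter, mem_missing] at hc
    exact Finset.sdiff_sdiff_eq_self hc.1.1
  · intro u hu
    simp only [Finset.mem_filter, Finset.mem_powerset] at hu
    exact Finset.sdiff_sdiff_eq_self hu.1
  · intro c hc
    rfl

theorem card_restriction_add_card_missing :
    (restriction E A).card + (missing E A).card = 2 ^ A.card := by
  rw [← Finset.card_powerset, ← Finset.card_filter_add_card_filter_not (s := A.powerset)
    (fun u => u ∈ E)]
  congr 1
  · congr 1
    ext e
    simp [mem_restriction, and_comm]
  · have := sum_missing_filter (E := E) (A := A) (fun _ => (1 : ℕ)) (fun _ => True)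
    simpa using this

theorem card_powerset_filter_mem (hy : y ∈ A) :
    (A.powerset.filter fun u => y ∈ u).card = 2 ^ (A.card - 1) := by
  have : (A.powerset.filter fun u => y ∈ u) = (A.erase y).powerset.image (insert y) := by
    ext u
    simp only [Finset.mem_filter, Finset.mem_powerset, Finset.mem_image]
    constructor
    · rintro ⟨h1, h2⟩
      exact ⟨u.erase y, Finset.erase_subset_erase _ h1, Finset.insert_erase h2⟩
    · rintro ⟨f, hf, rfl⟩
      exact ⟨Finset.insert_subset hy (hf.trans (Finset.erase_subset _ _)),
        Finset.mem_insert_self _ _⟩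
  rw [this, Finset.card_image_of_injOn, Finset.card_powerset, Finset.card_erase_of_mem hy]
  intro a ha b hb h
  have ha : y ∉ a := fun h => Finset.notMem_erase y A (Finset.mem_powerset.1 ha h)
  have hb : y ∉ b := fun h => Finset.notMem_erase y A (Finset.mem_powerset.1 hb h)
  rw [← Finset.erase_insert ha, ← Finset.erase_insert hb]
  exact congrArg (fun s => s.erase y) h

theorem card_openStar_restriction_add (hy : y ∈ A) :
    (openStar (restriction E A) y).card + (deletion (missing E A) y).card = 2 ^ (A.card - 1) := by
  rw [← card_powerset_filter_mem hy,
    ← Finset.card_filter_add_card_filter_not (s := A.powerset.filter fun u => y ∈ u)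
      (fun u => u ∈ E)]
  congr 1
  · congr 1
    ext e
    simp only [mem_openStar, mem_restriction, Finset.mem_filter, Finset.mem_powerset]
    tauto
  · have := sum_missing_filter (E := E) (A := A) (fun _ => (1 : ℕ)) (fun u => y ∈ u)
    rw [← Finset.card_eq_sum_ones, ← Finset.card_eq_sum_ones] at this
    rw [Finset.filter_filter]
    convert this using 2
    · ext c
      simp [mem_deletion, hy]
    · ext c
      simp [and_comm]

theorem coneWeight_powerset (P : Finset V) :
    coneWeight P.powerset = ((2 : ℝ) ^ (P.card + 1) - 1) / (P.card + 1) := by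
  rw [← sum_binaryWeight_two_pow, ← integral_colexPoly, coneWeight_eq_integral]
  congr 1
  ext t
  rw [colexPoly_two_pow, add_comm, ← Finset.sum_pow_mul_eq_add_pow, sizePoly]
  simp

/-- An upper bound for the weight of a vertex of `A` that accounts for missing sets. -/
theorem faceWeight_restriction_le (hy : y ∈ A) :
    (A.card : ℝ) * faceWeight (openStar (restriction E A) y) +
      ((A.powerset.filter fun u => u ∉ E ∧ y ∈ u).card : ℝ) ≤ 2 ^ A.card - 1 := by
  have hA : 0 < A.card := Finset.card_pos.2 ⟨y, hy⟩
  have hA' : (0 : ℝ) < A.card := by exact_mod_cast hA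
  have htot : faceWeight (openStar A.powerset y) = ((2 : ℝ) ^ A.card - 1) / A.card := by
    have : link A.powerset y = (A.erase y).powerset := by
      ext f
      rw [mem_link, Finset.mem_powerset, Finset.mem_powerset, Finset.insert_subset_iff,
        Finset.subset_erase]
      tauto
    rw [faceWeight_openStar, this, coneWeight_powerset, Finset.card_erase_of_mem hy,
      Nat.sub_add_cancel hA]
    push_cast [Nat.cast_sub hA]
    simp
  have hsplit : openStar A.powerset y =
      openStar (restriction E A) y ∪ A.powerset.filter fun u => u ∉ E ∧ y ∈ u := by
    ext e
    simp only [mem_openStar, mem_restriction, Finset.mem_filter, Finset.mem_union,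
      Finset.mem_powerset]
    tauto
  have hdisj : Disjoint (openStar (restriction E A) y)
      (A.powerset.filter fun u => u ∉ E ∧ y ∈ u) := by
    rw [Finset.disjoint_left]
    intro e h1 h2
    exact (Finset.mem_filter.1 h2).2.1 (mem_restriction.1 (mem_openStar.1 h1).1).1
  have hle : ((A.powerset.filter fun u => u ∉ E ∧ y ∈ u).card : ℝ) / A.card ≤
      faceWeight (A.powerset.filter fun u => u ∉ E ∧ y ∈ u) := by
    rw [faceWeight, div_eq_mul_one_div, ← nsmul_eq_mul, ← Finset.sum_const]
    refine Finset.sum_le_sum fun u hu => ?_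
    simp only [Finset.mem_filter, Finset.mem_powerset] at hu
    have h1 : (0 : ℝ) < u.card := by exact_mod_cast Finset.card_pos.2 ⟨y, hu.2.2⟩
    have h2 : (u.card : ℝ) ≤ A.card := by exact_mod_cast Finset.card_le_card hu.1
    exact one_div_le_one_div_of_le h1 h2
  have hsum : faceWeight (openStar A.powerset y) = faceWeight (openStar (restriction E A) y) +
      faceWeight (A.powerset.filter fun u => u ∉ E ∧ y ∈ u) := by
    rw [hsplit, faceWeight, Finset.sum_union hdisj]
    rfl
  rw [htot] at hsum
  rw [div_le_iff₀ hA'] at hle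
  rw [div_eq_iff hA'.ne'] at hsum
  linarith

theorem IsLowerSet.mem_support_openStar (hE : IsLowerSet (E : Set (Finset V))) :
    y ∈ support (openStar E x) ↔ {x, y} ∈ E := by
  simp only [support, Finset.mem_biUnion, mem_openStar, id]
  constructor
  · rintro ⟨e, ⟨he, hx⟩, hy⟩
    exact hE.mem_of_subset he (by simp [Finset.insert_subset_iff, hx, hy])
  · exact fun h => ⟨_, ⟨h, by simp⟩, by simp⟩

/-- The sets obtained from an edge leaving `A` at `y` through `z`. -/
theorem IsLowerSet.exists_subset_leaving (hE : IsLowerSet (E : Set (Finset V))) {z : V}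
    {T : Finset V} (hyz : y ≠ z) (hzA : z ∉ A) (hyT : y ∉ T) (hzT : z ∉ T)
    (hT : insert y (insert z T) ∈ E) :
    ∃ G ⊆ leaving E A y, G.card = 2 ^ T.card ∧
      faceWeight G = ∑ i ∈ Finset.range (T.card + 1), (T.card.choose i : ℝ) / (i + 2) := by
  have hinj : Set.InjOn (fun f : Finset V => insert y (insert z f)) T.powerset := by
    intro a ha b hb h
    have ha := Finset.mem_powerset.1 ha
    have hb := Finset.mem_powerset.1 hb
    have key : ∀ a ⊆ T, (insert y (insert z a)) \ {y, z} = a := by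
      intro a ha
      ext w
      have h1 : w ∈ a → w ≠ y := fun hw h => hyT (h ▸ ha hw)
      have h2 : w ∈ a → w ≠ z := fun hw h => hzT (h ▸ ha hw)
      simp only [Finset.mem_sdiff, Finset.mem_insert, Finset.mem_singleton]
      tauto
    rw [← key a ha, ← key b hb]
    exact congrArg (fun s => s \ {y, z}) h
  refine ⟨T.powerset.image fun f => insert y (insert z f), ?_, ?_, ?_⟩
  · intro e he
    obtain ⟨f, hf, rfl⟩ := Finset.mem_image.1 he
    refine mem_leaving.2 ⟨⟨hE.mem_of_subset hT ?_, by simp⟩, fun h => hzA (h (by simp))⟩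
    exact Finset.insert_subset_insert _ (Finset.insert_subset_insert _ (Finset.mem_powerset.1 hf))
  · rw [Finset.card_image_of_injOn hinj, Finset.card_powerset]
  · rw [faceWeight, Finset.sum_image hinj]
    have h : ∀ f ∈ T.powerset, 1 / ((insert y (insert z f)).card : ℝ) =
        (fun k : ℕ => 1 / ((k : ℝ) + 2)) f.card := by
      intro f hf
      have hf := Finset.mem_powerset.1 hf
      rw [Finset.card_insert_of_notMem, Finset.card_insert_of_notMem fun h => hzT (hf h)]
      · push_cast
        ring
      · simp only [Finset.mem_insert, not_or]
        exact ⟨hyz, fun h => hyT (hf h)⟩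
    rw [Finset.sum_congr rfl h, Finset.sum_powerset_apply_card (fun k : ℕ => 1 / ((k : ℝ) + 2))]
    refine Finset.sum_congr rfl fun i _ => ?_
    rw [nsmul_eq_mul]
    ring

/-- The constant is `17/12 = 1/2 + 2/3 + 1/4`, the weight of the four leaving subsets of a 4-element
edge through two fixed vertices. -/
theorem cap_le_of_four_le {j : ℕ} {c : ℝ} (hj : (j : ℝ) ≤ c) (hc : 4 ≤ c) :
    cap j ≤ 17 / 12 + (c - 4) / 4 := by
  rcases lt_or_ge j 7 with h | h
  · interval_cases j <;> norm_num [cap] at hj ⊢ <;> linarith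
  · have : (7 : ℝ) ≤ j := by exact_mod_cast h
    rw [cap_of_seven_le h]
    linarith

theorem cap_le_of_one_le {j : ℕ} {c : ℝ} (h1 : 1 ≤ j) (hj : (j : ℝ) ≤ c) :
    cap j ≤ 1 / 2 + (c - 1) / 3 := by
  rcases lt_or_ge j 7 with h | h
  · interval_cases j <;> norm_num [cap] at hj ⊢ <;> linarith
  · have : (7 : ℝ) ≤ j := by exact_mod_cast h
    rw [cap_of_seven_le h]
    linarith

theorem IsLowerSet.cap_le_faceWeight_leaving (hE : IsLowerSet (E : Set (Finset V)))
    (hy : y ∈ A) {j : ℕ} (hj : j ≤ (leaving E A y).card) : cap j ≤ faceWeight (leaving E A y) := by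
  rcases Nat.eq_zero_or_pos j with rfl | hj0
  · exact faceWeight_nonneg
  -- the general estimate when all leaving members have at most `s` elements
  have hrest : ∀ (s : ℕ) (G : Finset (Finset V)), 0 < s → G ⊆ leaving E A y →
      (∀ e ∈ leaving E A y, e.card ≤ s) →
      faceWeight G + ((leaving E A y).card - (G.card : ℝ)) / s ≤ faceWeight (leaving E A y) := by
    intro s G hs hG hle
    have h1 : faceWeight (leaving E A y \ G) + faceWeight G = faceWeight (leaving E A y) :=
      Finset.sum_sdiff hG
    have h2 : ((leaving E A y).card - (G.card : ℝ)) = ((leaving E A y \ G).card : ℝ) := by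
      rw [Finset.card_sdiff_of_subset hG, Nat.cast_sub (Finset.card_le_card hG)]
    have h3 : ((leaving E A y \ G).card : ℝ) * (1 / s) ≤ faceWeight (leaving E A y \ G) := by
      rw [← nsmul_eq_mul, ← Finset.sum_const]
      refine Finset.sum_le_sum fun e he => ?_
      have he := (Finset.mem_sdiff.1 he).1
      have : (0 : ℝ) < e.card := by
        exact_mod_cast Finset.card_pos.2 ⟨y, (mem_leaving.1 he).1.2⟩
      exact one_div_le_one_div_of_le this (by exact_mod_cast hle e he)
    rw [h2, div_eq_mul_one_div]
    linarith
  -- Fix `y` and a point `z` of `e` outside `A`: every subset of `e` containing both leaves `A`.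
  have hsub : ∀ e ∈ leaving E A y, ∀ k, k + 2 ≤ e.card → ∃ G ⊆ leaving E A y, G.card = 2 ^ k ∧
      faceWeight G = ∑ i ∈ Finset.range (k + 1), (k.choose i : ℝ) / (i + 2) := by
    intro e he k hk
    obtain ⟨⟨heE, hye⟩, heA⟩ := mem_leaving.1 he
    obtain ⟨z, hze, hzA⟩ := Finset.not_subset.1 heA
    have hyz : y ≠ z := fun h => hzA (h ▸ hy)
    have hcard : k ≤ ((e.erase y).erase z).card := by
      rw [Finset.card_erase_of_mem (Finset.mem_erase.2 ⟨hyz.symm, hze⟩),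
        Finset.card_erase_of_mem hye]
      omega
    obtain ⟨T, hT, rfl⟩ := Finset.exists_subset_card_eq hcard
    refine hE.exists_subset_leaving hyz hzA (fun h => ?_) (fun h => ?_)
      (hE.mem_of_subset heE ?_)
    · exact Finset.notMem_erase y e (Finset.mem_of_mem_erase (hT h))
    · exact Finset.notMem_erase z _ (hT h)
    · rw [Finset.insert_subset_iff, Finset.insert_subset_iff]
      exact ⟨hye, hze, hT.trans ((Finset.erase_subset _ _).trans (Finset.erase_subset _ _))⟩
  have hjR : (j : ℝ) ≤ (leaving E A y).card := by exact_mod_cast hj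
  obtain ⟨e₀, he₀⟩ := Finset.card_pos.1 (hj0.trans_le hj)
  have he₀2 : 2 ≤ e₀.card := by
    obtain ⟨⟨-, hye⟩, heA⟩ := mem_leaving.1 he₀
    obtain ⟨z, hze, hzA⟩ := Finset.not_subset.1 heA
    exact Finset.one_lt_card.2 ⟨y, hye, z, hze, fun h => hzA (h ▸ hy)⟩
  -- Such an edge alone yields `1/2 + 1 + 3/4 + 1/5 > 2`, the largest value of `cap`.
  by_cases h5 : ∃ e ∈ leaving E A y, 5 ≤ e.card
  · obtain ⟨e, he, he5⟩ := h5
    obtain ⟨G, hG, -, hw⟩ := hsub e he 3 he5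
    have h1 := faceWeight_mono hG
    rw [hw] at h1
    norm_num [Finset.sum_range_succ, Nat.choose] at h1
    have h2 : cap j ≤ 2 := by
      rcases lt_or_ge j 7 with h | h
      · interval_cases j <;> norm_num [cap]
      · rw [cap_of_seven_le h]
    linarith
  push Not at h5
  by_cases h4 : ∃ e ∈ leaving E A y, 4 ≤ e.card
  · obtain ⟨e, he, he4⟩ := h4
    obtain ⟨G, hG, hGc, hw⟩ := hsub e he 2 he4
    have h1 := hrest 4 G (by norm_num) hG fun e he => Nat.lt_succ_iff.1 (h5 e he)
    have h2 : (4 : ℝ) ≤ (leaving E A y).card := by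
      exact_mod_cast (by simpa [hGc] using Finset.card_le_card hG :
        4 ≤ (leaving E A y).card)
    rw [hw, hGc] at h1
    norm_num [Finset.sum_range_succ, Nat.choose] at h1
    linarith [cap_le_of_four_le hjR h2]
  push Not at h4
  obtain ⟨G, hG, hGc, hw⟩ := hsub e₀ he₀ 0 he₀2
  have h1 := hrest 3 G (by norm_num) hG fun e he => Nat.lt_succ_iff.1 (h4 e he)
  rw [hw, hGc] at h1
  norm_num [Finset.sum_range_succ, Nat.choose] at h1
  linarith [cap_le_of_one_le hj0 hjR]

end weights

/-! ### Redistribution between classes for `d ≥ 4`. -/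

section redistribution

variable {V : Type u} [DecidableEq V] {E : Finset (Finset V)} {A : Finset V} {x y z : V} {d m : ℕ}

/-- The vertices sharing an edge with `x`, including `x` itself. -/
def closedNbhd (E : Finset (Finset V)) (x : V) : Finset V := support (openStar E x)

/-- The vertices with the smallest closed neighbourhood that the degree condition permits. -/
def tightVertices (E : Finset (Finset V)) (d : ℕ) : Finset V :=
  (support E).filter fun x => (closedNbhd E x).card = d + 1

/-- A lower set all whose vertices have degree larger than `2 ^ d - m`, for `d ≥ 4`. -/
structure LargeDegrees (E : Finset (Finset V)) (d m : ℕ) : Prop where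
  lower : IsLowerSet (E : Set (Finset V))
  four_le : 4 ≤ d
  one_le : 1 ≤ m
  le : m ≤ d
  degree : ∀ x ∈ support E, 2 ^ d - m + 1 ≤ (openStar E x).card

theorem mem_tightVertices :
    x ∈ tightVertices E d ↔ x ∈ support E ∧ (closedNbhd E x).card = d + 1 :=
  Finset.mem_filter

/-- The second bound fails at `d = 3`, the case treated separately. -/
theorem le_two_pow_sub {d : ℕ} (hd : 4 ≤ d) : d ≤ 2 ^ (d - 1) ∧ d ≤ 2 ^ (d - 2) := by
  induction d, hd using Nat.le_induction with
  | base => norm_num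
  | succ k hk ih =>
    rw [show k + 1 - 1 = (k - 1) + 1 by omega, show k + 1 - 2 = (k - 2) + 1 by omega, pow_succ,
      pow_succ]
    omega

theorem subset_closedNbhd {e : Finset V} (he : e ∈ E) (hx : x ∈ e) : e ⊆ closedNbhd E x :=
  subset_support (mem_openStar.2 ⟨he, hx⟩)

theorem openStar_restriction_closedNbhd :
    openStar (restriction E (closedNbhd E x)) x = openStar E x := by
  ext e
  simp only [mem_openStar, mem_restriction]
  exact ⟨fun h => ⟨h.1.1, h.2⟩, fun h => ⟨⟨h.1, subset_closedNbhd h.1 h.2⟩, h.2⟩⟩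

theorem restriction_subset_powerset : ∀ e ∈ restriction E A, e ⊆ A :=
  fun _ he => (mem_restriction.1 he).2

namespace LargeDegrees

theorem mem_closedNbhd (h : LargeDegrees E d m) : y ∈ closedNbhd E x ↔ {x, y} ∈ E :=
  h.lower.mem_support_openStar

theorem self_mem (h : LargeDegrees E d m) (hx : x ∈ support E) : x ∈ closedNbhd E x := by
  rw [h.mem_closedNbhd]
  simpa using h.lower.mem_support.1 hx

theorem closedNbhd_subset (h : LargeDegrees E d m) : closedNbhd E x ⊆ support E := fun y hy =>
  h.lower.mem_support.2 (h.lower.mem_of_subset (h.mem_closedNbhd.1 hy) (by simp))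

theorem le_card_closedNbhd (h : LargeDegrees E d m) (hx : x ∈ support E) :
    d + 1 ≤ (closedNbhd E x).card := by
  have h1 := h.degree x hx
  have h2 := card_openStar_restriction_add (E := E) (h.self_mem hx)
  rw [openStar_restriction_closedNbhd] at h2
  by_contra! hlt
  have h3 : 2 ^ ((closedNbhd E x).card - 1) ≤ 2 ^ (d - 1) :=
    Nat.pow_le_pow_right (by norm_num) (by omega)
  have h4 := (le_two_pow_sub h.four_le).1
  have h5 : 2 ^ d = 2 * 2 ^ (d - 1) := by
    rw [← pow_succ', Nat.sub_add_cancel (by linarith [h.four_le])]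
  have := h.le
  omega

theorem card_deletion_missing_lt (h : LargeDegrees E d m) (hx : x ∈ tightVertices E d) :
    (deletion (missing E (closedNbhd E x)) x).card + 1 ≤ m := by
  obtain ⟨hx, hc⟩ := mem_tightVertices.1 hx
  have h1 := h.degree x hx
  have h2 := card_openStar_restriction_add (E := E) (h.self_mem hx)
  rw [openStar_restriction_closedNbhd, hc, Nat.add_sub_cancel] at h2
  have := h.one_le
  have := (h.le.trans Nat.lt_two_pow_self.le : m ≤ 2 ^ d)
  omega

/-- If `z` and `w` in the neighbourhood were not adjacent, each subset avoiding `x, z, w` would be a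
missing complement avoiding `x`. That makes at least `2^(d-2) ≥ d ≥ m` of them, but fewer than `m`
are allowed. -/
theorem closedNbhd_subset_of_tight (h : LargeDegrees E d m) (hx : x ∈ tightVertices E d)
    (hz : z ∈ closedNbhd E x) : closedNbhd E x ⊆ closedNbhd E z := by
  intro w hw
  rw [h.mem_closedNbhd]
  by_contra hzw
  have hle : ((closedNbhd E x) \ {x, z, w}).powerset ⊆
      deletion (missing E (closedNbhd E x)) x := by
    intro c hc
    rw [Finset.mem_powerset] at hc
    have hx' : ∀ v ∈ ({x, z, w} : Finset V), v ∉ c := fun v hv hvc =>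
      (Finset.mem_sdiff.1 (hc hvc)).2 hv
    refine mem_deletion.2 ⟨mem_missing.2 ⟨hc.trans Finset.sdiff_subset, fun hE => hzw ?_⟩,
      hx' x (by simp)⟩
    refine h.lower.mem_of_subset hE ?_
    rw [Finset.insert_subset_iff, Finset.singleton_subset_iff, Finset.mem_sdiff,
      Finset.mem_sdiff]
    exact ⟨⟨hz, hx' z (by simp)⟩, hw, hx' w (by simp)⟩
  have h1 := Finset.card_le_card hle
  rw [Finset.card_powerset] at h1
  have h2 := h.card_deletion_missing_lt hx
  have h3 : d - 2 ≤ ((closedNbhd E x) \ {x, z, w}).card := by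
    have := Finset.le_card_sdiff ({x, z, w} : Finset V) (closedNbhd E x)
    have h4 : ({x, z, w} : Finset V).card ≤ 3 := Finset.card_le_three
    rw [(mem_tightVertices.1 hx).2] at this
    omega
  have h4 : 2 ^ (d - 2) ≤ 2 ^ ((closedNbhd E x) \ {x, z, w}).card :=
    Nat.pow_le_pow_right (by norm_num) h3
  have := (le_two_pow_sub h.four_le).2
  have := h.le
  omega

theorem closedNbhd_eq_of_tight (h : LargeDegrees E d m) (hx : x ∈ tightVertices E d)
    (hz : z ∈ closedNbhd E x) (hzt : z ∈ tightVertices E d) : closedNbhd E z = closedNbhd E x :=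
  (Finset.eq_of_subset_of_card_le (h.closedNbhd_subset_of_tight hx hz) (by
    rw [(mem_tightVertices.1 hx).2, (mem_tightVertices.1 hzt).2])).symm

end LargeDegrees

/-- The number of missing sets beyond what a component isomorphic to the extremal one may have. -/
def excess (E : Finset (Finset V)) (m : ℕ) (A : Finset V) : ℕ := (missing E A).card + 1 - m

/-- The bound on the amount transferred from `y` to the tight vertices of `A`. -/
noncomputable def transferCap (E : Finset (Finset V)) (m : ℕ) (A : Finset V) (y : V) : ℝ :=
  if y ∈ support (missing E A) then
    if excess E m A = 0 then 0 else if excess E m A < 7 then 1 / 2 else 1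
  else cap (excess E m A)

/-- The part of the weight of edges leaving `A` at `y` that is made available to `A`. -/
noncomputable def transfer (E : Finset (Finset V)) (m : ℕ) (A : Finset V) (y : V) : ℝ :=
  min (faceWeight (leaving E A y)) (transferCap E m A y)

theorem transferCap_nonneg : 0 ≤ transferCap E m A y := by
  unfold transferCap
  split_ifs
  · exact le_rfl
  · norm_num
  · norm_num
  · exact cap_nonneg _

theorem transfer_nonneg : 0 ≤ transfer E m A y := le_min faceWeight_nonneg transferCap_nonneg

namespace LargeDegrees

theorem one_le_card_leaving (h : LargeDegrees E d m) (hx : x ∈ tightVertices E d)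
    (hy : y ∈ closedNbhd E x) (hyt : y ∉ tightVertices E d) :
    1 ≤ (leaving E (closedNbhd E x) y).card := by
  have hys := h.closedNbhd_subset hy
  have h1 := h.le_card_closedNbhd hys
  have h2 : (closedNbhd E y).card ≠ d + 1 := fun h' => hyt (mem_tightVertices.2 ⟨hys, h'⟩)
  obtain ⟨z, hz, hzA⟩ : ∃ z ∈ closedNbhd E y, z ∉ closedNbhd E x := by
    by_contra! hcon
    have := Finset.card_le_card hcon
    rw [(mem_tightVertices.1 hx).2] at this
    omega
  exact Finset.card_pos.2 ⟨{y, z}, mem_leaving.2 ⟨⟨h.mem_closedNbhd.1 hz, by simp⟩,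
    fun hs => hzA (hs (by simp))⟩⟩

/-- The missing sets through `y` correspond to the missing complements avoiding `y`; the degree
condition forces leaving edges to make up for them beyond `m - 1`. -/
theorem excess_le_leaving (h : LargeDegrees E d m) (hx : x ∈ tightVertices E d)
    (hy : y ∈ closedNbhd E x) :
    excess E m (closedNbhd E x) ≤
      (leaving E (closedNbhd E x) y).card + (openStar (missing E (closedNbhd E x)) y).card := by
  have h1 := card_restriction_add_leaving (E := E) (A := closedNbhd E x) (y := y)
  have h2 := h.degree y (h.closedNbhd_subset hy)
  have h3 := card_openStar_restriction_add (E := E) hy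
  have h4 := card_deletion_add_card_openStar (E := missing E (closedNbhd E x)) (v := y)
  rw [(mem_tightVertices.1 hx).2, Nat.add_sub_cancel] at h3
  have := (h.le.trans Nat.lt_two_pow_self.le : m ≤ 2 ^ d)
  unfold excess
  omega

theorem excess_le_openStar (h : LargeDegrees E d m) (hx : x ∈ tightVertices E d) :
    excess E m (closedNbhd E x) ≤ (openStar (missing E (closedNbhd E x)) x).card := by
  have h4 := card_deletion_add_card_openStar (E := missing E (closedNbhd E x)) (v := x)
  have := h.card_deletion_missing_lt hx
  unfold excess
  omega

/-- In a lower set the star of `x` is at most as large as the deletion, which has fewer than `m`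
members here. -/
theorem excess_lt (h : LargeDegrees E d m) (hx : x ∈ tightVertices E d) :
    excess E m (closedNbhd E x) + 1 ≤ m := by
  have h1 := h.excess_le_openStar hx
  have h2 := Finset.card_le_card
    ((h.lower.isLowerSet_missing (closedNbhd E x)).link_subset_deletion x)
  rw [card_link] at h2
  have h3 := h.card_deletion_missing_lt hx
  omega

theorem le_sum_transfer (h : LargeDegrees E d m) (hx : x ∈ tightVertices E d) :
    ((missing E (closedNbhd E x)).card : ℝ) + 1 - m ≤
      ∑ y ∈ closedNbhd E x \ tightVertices E d, transfer E m (closedNbhd E x) y := by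
  set A := closedNbhd E x with hA
  rcases Nat.eq_zero_or_pos (excess E m A) with h0 | hpos
  · have : ((missing E A).card : ℝ) + 1 ≤ m := by
      unfold excess at h0
      exact_mod_cast (by omega : (missing E A).card + 1 ≤ m)
    have := Finset.sum_nonneg (s := A \ tightVertices E d)
      (fun y _ => transfer_nonneg (E := E) (m := m) (A := A) (y := y))
    linarith
  have hcard : (missing E A).card + 1 = m + excess E m A := by
    unfold excess at hpos ⊢
    omega
  have hcardR : ((missing E A).card : ℝ) + 1 - m = excess E m A := by
    have : ((missing E A).card : ℝ) + 1 = m + excess E m A := by exact_mod_cast hcard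
    linarith
  rw [hcardR]
  have hsd : A \ tightVertices E d = A \ (A ∩ tightVertices E d) := by simp
  rw [hsd]
  have hmem : ∀ y ∈ A \ (A ∩ tightVertices E d), y ∈ A ∧ y ∉ tightVertices E d := by
    intro y hy
    rw [← hsd] at hy
    exact Finset.mem_sdiff.1 hy
  have hC := h.lower.isLowerSet_missing A
  have hcapge : ∀ y, 1 / 2 ≤ transferCap E m A y := by
    intro y
    unfold transferCap
    split_ifs
    · omega
    · exact le_rfl
    · norm_num
    · exact half_le_cap hpos
  refine le_sum_of_card_missing hC (fun c hc => (mem_missing.1 hc).1) (mem_tightVertices.1 hx).2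
    h.four_le h.le hcard hpos
    ⟨x, Finset.mem_inter.2 ⟨h.self_mem (mem_tightVertices.1 hx).1, hx⟩⟩ ?_ ?_ ?_ ?_
  · intro z hz
    obtain ⟨hzA, hzt⟩ := Finset.mem_inter.1 hz
    have := h.excess_le_openStar hzt
    rwa [h.closedNbhd_eq_of_tight hx hzA hzt] at this
  · intro y hy
    obtain ⟨hyA, hyt⟩ := hmem y hy
    exact le_min (h.lower.cap_le_faceWeight_leaving hyA (h.one_le_card_leaving hx hyA hyt)) (hcapge y)
  · intro y hy hys
    obtain ⟨hyA, hyt⟩ := hmem y hy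
    refine le_min (h.lower.cap_le_faceWeight_leaving hyA ?_) ?_
    · have h1 := h.excess_le_leaving hx hyA
      rw [← hA] at h1
      have h2 : (openStar (missing E A) y).card = 0 := by
        rw [Finset.card_eq_zero, Finset.eq_empty_iff_forall_notMem]
        intro c hc
        exact hys (subset_support (mem_openStar.1 hc).1 (mem_openStar.1 hc).2)
      omega
    · rw [transferCap, if_neg hys]
  · intro h7 y hy hle
    obtain ⟨hyA, hyt⟩ := hmem y hy
    refine le_min (h.lower.cap_le_faceWeight_leaving (j := 3) hyA ?_) ?_
    · have h1 := h.excess_le_leaving hx hyA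
      rw [← hA] at h1
      omega
    · unfold transferCap
      split_ifs
      · omega
      · omega
      · exact le_rfl
      · rw [cap_of_seven_le h7]; norm_num

/-- The edges inside a class number `2^(d+1)` minus the missing sets, against a target of `2^(d+1) -
m` for the non-empty ones. `le_sum_transfer` covers the difference. -/
theorem sum_restriction_add_transfer_nonneg (h : LargeDegrees E d m)
    (hx : x ∈ tightVertices E d) :
    0 ≤ ∑ y ∈ closedNbhd E x, (faceWeight (openStar (restriction E (closedNbhd E x)) y) -
      alphaValue d m + if y ∈ tightVertices E d then 0 else transfer E m (closedNbhd E x) y) := by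
  have h1 := h.le_sum_transfer hx
  obtain ⟨hxs, hcard⟩ := mem_tightVertices.1 hx
  have h2 := sum_faceWeight_openStar (restriction_subset_powerset (E := E) (A := closedNbhd E x))
  have h3 := card_restriction_add_card_missing (E := E) (A := closedNbhd E x)
  have h4 : ∅ ∈ restriction E (closedNbhd E x) :=
    mem_restriction.2 ⟨h.lower.empty_mem ⟨_, h.lower.mem_support.1 hxs⟩, Finset.empty_subset _⟩
  have h5 := Finset.card_erase_add_one h4
  rw [Finset.sum_add_distrib, Finset.sum_sub_distrib, h2, Finset.sum_const, hcard, nsmul_eq_mul]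
  rw [Finset.sum_ite, Finset.sum_const_zero, zero_add, ← Finset.sdiff_eq_filter]
  have h6 : (((restriction E (closedNbhd E x)).erase ∅).card : ℝ) + 1 +
      (missing E (closedNbhd E x)).card = 2 ^ (d + 1) := by
    rw [← hcard]
    exact_mod_cast (by omega : _ + 1 + (missing E (closedNbhd E x)).card = _)
  have h7 : ((d + 1 : ℕ) : ℝ) * alphaValue d m = 2 ^ (d + 1) - m := by
    rw [alphaValue]
    push_cast
    field_simp
  rw [h7]
  linarith

/-- A vertex in two classes has enough weight for both. -/
theorem transfer_add_transfer_le (h : LargeDegrees E d m) (hx : x ∈ tightVertices E d)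
    (hz : z ∈ tightVertices E d) (hyx : y ∈ closedNbhd E x) (hxy : y ≠ x) :
    transfer E m (closedNbhd E x) y + transfer E m (closedNbhd E z) y ≤
      alphaValue d m - faceWeight (openStar (restriction E ((closedNbhd E x).erase x)) y) := by
  obtain ⟨hxs, hcard⟩ := mem_tightVertices.1 hx
  have hgx := h.excess_lt hx
  have hgz := h.excess_lt hz
  have hmd := h.le
  have hd4 := h.four_le
  have hyA' : y ∈ (closedNbhd E x).erase x := Finset.mem_erase.2 ⟨hxy, hyx⟩
  have hbound := faceWeight_restriction_le (E := E) hyA'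
  rw [Finset.card_erase_of_mem (h.self_mem hxs), hcard, Nat.add_sub_cancel] at hbound
  set w := faceWeight (openStar (restriction E ((closedNbhd E x).erase x)) y) with hw
  set μ := ((closedNbhd E x).erase x).powerset.filter fun u => u ∉ E ∧ y ∈ u with hμ
  have hμ0 : (0 : ℝ) ≤ μ.card := by positivity
  have ht : ∀ A, transfer E m A y ≤ transferCap E m A y := fun A => min_le_right _ _
  have htx := ht (closedNbhd E x)
  have htz := ht (closedNbhd E z)
  have hcapx : ∀ A, transferCap E m A y ≤ max 1 (cap (excess E m A)) := by
    intro A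
    unfold transferCap
    split_ifs <;> norm_num
  have htx' := hcapx (closedNbhd E x)
  have htz' := hcapx (closedNbhd E z)
  have hα : alphaValue d m * (d + 1) = 2 ^ (d + 1) - m := by
    rw [alphaValue]
    field_simp
  have hcap2 : ∀ g, cap g ≤ 2 := by
    intro g
    rcases lt_or_ge g 7 with hg | hg
    · interval_cases g <;> norm_num [cap]
    · rw [cap_of_seven_le hg]
  -- For `d ≥ 6` the right-hand side is at least 4 and each transfer is at most 2. For `d = 5` the
  -- excess is at most 4, capping each transfer at `4/3`. For `d = 4` the two caps may total 2 while
  -- the crude lower bound is only `28/5 - 15/4 < 2`, so missing sets must be counted.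
  rcases (by omega : d = 4 ∨ d = 5 ∨ 6 ≤ d) with rfl | rfl | hd6
  · norm_num at hα hbound
    have hmdR : (m : ℝ) ≤ 4 := by exact_mod_cast hmd
    have hcapz : cap (excess E m (closedNbhd E z)) ≤ 1 := by
      have : excess E m (closedNbhd E z) ≤ 3 := by omega
      interval_cases excess E m (closedNbhd E z) <;> norm_num [cap]
    rw [max_eq_left hcapz] at htz'
    by_cases hys : y ∈ support (missing E (closedNbhd E x))
    · have : transferCap E m (closedNbhd E x) y ≤ 3 / 4 := by
        rw [transferCap, if_pos hys]
        split_ifs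
        · norm_num
        · norm_num
        · omega
      linarith
    · have hcx : transferCap E m (closedNbhd E x) y = cap (excess E m (closedNbhd E x)) := by
        rw [transferCap, if_neg hys]
      have hμg : excess E m (closedNbhd E x) ≤ μ.card := by
        -- A missing complement containing `x` but not `y` yields a missing set through `y` inside
        -- the class without `x`, and this lowers `w`.
        refine (h.excess_le_openStar hx).trans ?_
        refine Finset.card_le_card_of_injOn (fun c => closedNbhd E x \ c) ?_ ?_
        · intro c hc
          obtain ⟨hc, hxc⟩ := mem_openStar.1 hc
          obtain ⟨hcA, hcE⟩ := mem_missing.1 hc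
          simp only [hμ, Finset.coe_filter, Finset.mem_powerset, Set.mem_ofPred_eq,
            Finset.mem_sdiff]
          refine ⟨?_, hcE, hyx, fun hyc => hys (subset_support hc hyc)⟩
          rw [Finset.subset_erase]
          exact ⟨Finset.sdiff_subset, fun hx' => (Finset.mem_sdiff.1 hx').2 hxc⟩
        · intro a ha b hb hab
          have ha := (mem_missing.1 (mem_openStar.1 ha).1).1
          have hb := (mem_missing.1 (mem_openStar.1 hb).1).1
          rw [← Finset.sdiff_sdiff_eq_self ha, ← Finset.sdiff_sdiff_eq_self hb]
          exact congrArg (fun s => closedNbhd E x \ s) hab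
      have hμgR : (excess E m (closedNbhd E x) : ℝ) ≤ μ.card := by exact_mod_cast hμg
      have : excess E m (closedNbhd E x) ≤ 3 := by omega
      have hc4 : cap (excess E m (closedNbhd E x)) ≤
          3 / 4 + (excess E m (closedNbhd E x) : ℝ) / 4 := by
        interval_cases excess E m (closedNbhd E x) <;> norm_num [cap]
      linarith
  · have hcap5 : ∀ A, excess E m A + 1 ≤ m → max 1 (cap (excess E m A)) ≤ 4 / 3 := by
      intro A hA
      have : excess E m A ≤ 4 := by omega
      refine max_le (by norm_num) ?_
      interval_cases excess E m A <;> norm_num [cap]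
    have h1 := hcap5 _ hgx
    have h2 := hcap5 _ hgz
    norm_num at hα hbound
    have hmdR : (m : ℝ) ≤ 5 := by exact_mod_cast hmd
    linarith
  · have h1 : max 1 (cap (excess E m (closedNbhd E x))) ≤ 2 := max_le (by norm_num) (hcap2 _)
    have h2 : max 1 (cap (excess E m (closedNbhd E z))) ≤ 2 := max_le (by norm_num) (hcap2 _)
    have hpow : (8 * d : ℝ) ≤ 2 ^ d := by
      have : 8 * d ≤ 2 ^ d := by
        clear * - hd6
        induction d, hd6 using Nat.le_induction with
        | base => norm_num
        | succ k hk ih => rw [pow_succ]; omega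
      exact_mod_cast this
    have hmdR : (m : ℝ) ≤ d := by exact_mod_cast hmd
    have hd6R : (6 : ℝ) ≤ d := by exact_mod_cast hd6
    suffices 4 ≤ alphaValue d m - w by linarith
    have e1 : d * w ≤ 2 ^ d - 1 := by linarith
    have e2 : alphaValue d m * (d + 1) ≥ 2 * 2 ^ d - d := by rw [hα, pow_succ]; linarith
    have e3 : 4 * (d * (d + 1) : ℝ) ≤ (alphaValue d m - w) * (d * (d + 1)) := by
      nlinarith
    exact le_of_mul_le_mul_right e3 (by positivity)

/-- A vertex that is not tight can pay for all classes containing it. -/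
theorem sum_transfer_le (h : LargeDegrees E d m) (hy : y ∈ support E)
    (hyt : y ∉ tightVertices E d) :
    ∑ A ∈ ((tightVertices E d).image (closedNbhd E)).filter (fun A => y ∈ A),
      (faceWeight (openStar (restriction E A) y) - alphaValue d m + transfer E m A y) ≤
      faceWeight (openStar E y) - alphaValue d m := by
  set Q := ((tightVertices E d).image (closedNbhd E)).filter (fun A => y ∈ A) with hQ
  rcases Q.eq_empty_or_nonempty with hQ0 | ⟨A₁, hA₁⟩
  · rw [hQ0, Finset.sum_empty, sub_nonneg, faceWeight_openStar]
    refine (h.lower.isLowerSet_link y).alphaValue_le_coneWeight_of_support h.four_le h.one_le h.le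
      ?_ ?_
    · rw [card_link]
      exact h.degree y hy
    · have h1 := h.le_card_closedNbhd hy
      have h2 : (closedNbhd E y).card ≠ d + 1 := fun h' => hyt (mem_tightVertices.2 ⟨hy, h'⟩)
      have h3 : (closedNbhd E y).erase y ⊆ support (link E y) := by
        intro z hz
        obtain ⟨hzy, hz⟩ := Finset.mem_erase.1 hz
        exact h.lower.mem_support_link.2 ⟨hzy.symm, h.mem_closedNbhd.1 hz⟩
      have h4 := Finset.card_le_card h3
      rw [Finset.card_erase_of_mem (h.self_mem hy)] at h4
      omega
  have hrep : ∀ A ∈ Q, ∃ x ∈ tightVertices E d, closedNbhd E x = A ∧ y ∈ A := by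
    intro A hA
    obtain ⟨hA, hyA⟩ := Finset.mem_filter.1 hA
    obtain ⟨x, hx, rfl⟩ := Finset.mem_image.1 hA
    exact ⟨x, hx, rfl, hyA⟩
  have : Nonempty V := ⟨y⟩
  choose! c hct hcA hyA using hrep
  have hceq : ∀ A ∈ Q, ∀ A' ∈ Q, c A ∈ A' → A = A' := fun A hA A' hA' hc => by
    rw [← hcA A hA, ← hcA A' hA']
    exact h.closedNbhd_eq_of_tight (hct A' hA') (by rwa [hcA A' hA']) (hct A hA)
  have hyc : ∀ A ∈ Q, y ≠ c A := fun A hA he => hyt (he ▸ hct A hA)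
  rw [← Finset.add_sum_erase _ _ hA₁]
  rcases (Q.erase A₁).eq_empty_or_nonempty with hQ1 | hQ1
  · rw [hQ1, Finset.sum_empty, add_zero]
    have := faceWeight_restriction_add_leaving (E := E) (A := A₁) (y := y)
    have : transfer E m A₁ y ≤ faceWeight (leaving E A₁ y) := min_le_left _ _
    linarith
  have hmem : ∀ A ∈ Q.erase A₁, A ∈ Q := fun A hA => Finset.mem_of_mem_erase hA
  -- the edges through `y` and the representative of a further class
  have hD : ∀ A ∈ Q, faceWeight (openStar (restriction E A) y) =
      faceWeight (openStar (restriction E (A.erase (c A))) y) +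
        faceWeight ((openStar E y).filter fun e => c A ∈ e) := by
    intro A hA
    have hdisj : Disjoint (openStar (restriction E (A.erase (c A))) y)
        ((openStar E y).filter fun e => c A ∈ e) := by
      rw [Finset.disjoint_left]
      intro e h1 h2
      exact Finset.notMem_erase _ _
        ((mem_restriction.1 (mem_openStar.1 h1).1).2 (Finset.mem_filter.1 h2).2)
    have : openStar (restriction E A) y = openStar (restriction E (A.erase (c A))) y ∪
        (openStar E y).filter fun e => c A ∈ e := by
      ext e
      simp only [mem_openStar, mem_restriction, Finset.mem_union, Finset.mem_filter,
        Finset.subset_erase]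
      constructor
      · tauto
      · rintro (h1 | ⟨⟨h1, h2⟩, h3⟩)
        · tauto
        · refine ⟨⟨h1, ?_⟩, h2⟩
          rw [← hcA A hA]
          exact subset_closedNbhd h1 h3
    rw [this, faceWeight, Finset.sum_union hdisj]
    rfl
  -- Edges through `y` and `c A` leave `A₁`, and no edge contains two different representatives,
  -- since classes sharing a representative coincide.
  have hw : faceWeight (openStar (restriction E A₁) y) +
      ∑ A ∈ Q.erase A₁, faceWeight ((openStar E y).filter fun e => c A ∈ e) ≤
      faceWeight (openStar E y) := by
    rw [← faceWeight_restriction_add_leaving (E := E) (A := A₁) (y := y), add_le_add_iff_left]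
    simp only [faceWeight]
    rw [← Finset.sum_biUnion]
    · refine faceWeight_mono ?_
      intro e he
      obtain ⟨A, hA, he⟩ := Finset.mem_biUnion.1 he
      obtain ⟨he, hce⟩ := Finset.mem_filter.1 he
      refine mem_leaving.2 ⟨mem_openStar.1 he, fun hs => ?_⟩
      exact (Finset.mem_erase.1 hA).1 (hceq A (hmem A hA) A₁ hA₁ (hs hce))
    · intro A hA A' hA' hne
      rw [Function.onFun, Finset.disjoint_left]
      intro e h1 h2
      obtain ⟨he, hce⟩ := Finset.mem_filter.1 h1
      obtain ⟨-, hce'⟩ := Finset.mem_filter.1 h2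
      refine hne (hceq A (hmem A hA) A' (hmem A' hA') ?_)
      rw [← hcA A' (hmem A' hA')]
      exact subset_closedNbhd (mem_openStar.1 he).1 hce' hce
  -- Each further class pays its own transfer and that of `A₁`; a single further class is already
  -- enough to fund `A₁`.
  have hpair : ∀ A ∈ Q.erase A₁, faceWeight (openStar (restriction E A) y) - alphaValue d m +
      transfer E m A y ≤ faceWeight ((openStar E y).filter fun e => c A ∈ e) -
        transfer E m A₁ y := by
    intro A hA
    have hA := hmem A hA
    have h1 := h.transfer_add_transfer_le (hct A hA) (hct A₁ hA₁) (y := y)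
      (by rw [hcA A hA]; exact hyA A hA) (hyc A hA)
    rw [hcA A hA, hcA A₁ hA₁] at h1
    rw [hD A hA]
    linarith
  have hsum := Finset.sum_le_sum hpair
  rw [Finset.sum_sub_distrib, Finset.sum_const, nsmul_eq_mul] at hsum
  have h1 : (1 : ℝ) ≤ (Q.erase A₁).card := by exact_mod_cast Finset.card_pos.2 hQ1
  have h2 := mul_le_mul_of_nonneg_right h1 (transfer_nonneg (E := E) (m := m) (A := A₁) (y := y))
  linarith

theorem alphaValue_mul_card_le (h : LargeDegrees E d m) :
    alphaValue d m * (support E).card ≤ ((E.erase ∅).card : ℝ) := by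
  rw [← sum_faceWeight_openStar (F := E) (A := support E) fun e he => subset_support he,
    ← sub_nonneg, mul_comm, ← nsmul_eq_mul, ← Finset.sum_const, ← Finset.sum_sub_distrib]
  set Q := (tightVertices E d).image (closedNbhd E) with hQ
  have key : ∀ y ∈ support E, ∑ A ∈ Q.filter (fun A => y ∈ A),
      (faceWeight (openStar (restriction E A) y) - alphaValue d m +
        if y ∈ tightVertices E d then 0 else transfer E m A y) ≤
      faceWeight (openStar E y) - alphaValue d m := by
    intro y hy
    by_cases hyt : y ∈ tightVertices E d
    · have : Q.filter (fun A => y ∈ A) = {closedNbhd E y} := by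
        ext A
        simp only [hQ, Finset.mem_filter, Finset.mem_image, Finset.mem_singleton]
        constructor
        · rintro ⟨⟨x, hx, rfl⟩, hyA⟩
          exact (h.closedNbhd_eq_of_tight hx hyA hyt).symm
        · rintro rfl
          exact ⟨⟨y, hyt, rfl⟩, h.self_mem hy⟩
      rw [this, Finset.sum_singleton, if_pos hyt, openStar_restriction_closedNbhd, add_zero]
    · simp only [if_neg hyt]
      exact h.sum_transfer_le hy hyt
  refine le_trans ?_ (Finset.sum_le_sum key)
  simp only [Finset.sum_filter]
  rw [Finset.sum_comm]
  refine Finset.sum_nonneg fun A hA => ?_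
  obtain ⟨x, hx, rfl⟩ := Finset.mem_image.1 hA
  rw [← Finset.sum_filter]
  have : (support E).filter (fun y => y ∈ closedNbhd E x) = closedNbhd E x := by
    rw [Finset.filter_mem_eq_inter, Finset.inter_eq_right]
    exact h.closedNbhd_subset
  rw [this]
  exact h.sum_restriction_add_transfer_nonneg hx

end LargeDegrees

end redistribution

/-! ### The case `d = m = 3`. -/

section dimensionThree

variable {V : Type u} [DecidableEq V] {E L : Finset (Finset V)} {x y : V}

/-- The amount, in units of `1 / 12`, sent along a pair of vertices of the given codegree. -/
noncomputable def pairTransfer (n : ℕ) : ℝ := if n = 3 then 1 else if n = 2 then 1 / 2 else 0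

theorem pairTransfer_nonneg (n : ℕ) : 0 ≤ pairTransfer n := by
  unfold pairTransfer
  split_ifs <;> norm_num

theorem pairTransfer_le_one (n : ℕ) : pairTransfer n ≤ 1 := by
  unfold pairTransfer
  split_ifs <;> norm_num

/-- A family consisting of the empty set, three singletons and two pairs. -/
def IsCherry (L : Finset (Finset V)) : Prop :=
  (support L).card = 3 ∧ (bigMembers L).card = 2 ∧ ∀ f ∈ bigMembers L, f.card = 2

theorem IsLowerSet.coneWeight_eq (hL : IsLowerSet (L : Set (Finset V))) (hne : L.Nonempty) :
    coneWeight L = 1 + (support L).card / 2 + ∑ f ∈ bigMembers L, 1 / ((f.card : ℝ) + 1) := by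
  rw [coneWeight, hL.sum_eq_add _ hne]
  simp only [Finset.card_empty, Finset.card_singleton, Finset.sum_const, nsmul_eq_mul]
  push_cast
  ring

theorem card_pairs_div_three_le :
    (((bigMembers L).filter fun f => f.card = 2).card : ℝ) / 3 ≤
      ∑ f ∈ bigMembers L, 1 / ((f.card : ℝ) + 1) := by
  have h1 : ∑ f ∈ (bigMembers L).filter (fun f => f.card = 2), 1 / ((f.card : ℝ) + 1) =
      (((bigMembers L).filter fun f => f.card = 2).card : ℝ) / 3 := by
    rw [Finset.sum_congr rfl fun f hf => by
      rw [(Finset.mem_filter.1 hf).2], Finset.sum_const, nsmul_eq_mul]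
    push_cast
    ring
  rw [← h1]
  exact Finset.sum_le_sum_of_subset_of_nonneg (Finset.filter_subset _ _)
    fun _ _ _ => by positivity

theorem IsLowerSet.three_le_card_pairs (hL : IsLowerSet (L : Set (Finset V))) {f : Finset V}
    (hf : f ∈ bigMembers L) (h2 : f.card ≠ 2) :
    3 ≤ ((bigMembers L).filter fun f => f.card = 2).card := by
  obtain ⟨hfL, hf2⟩ := mem_bigMembers.1 hf
  obtain ⟨T, hT, hT3⟩ := Finset.exists_subset_card_eq (show 3 ≤ f.card by omega)
  have : T.powersetCard 2 ⊆ (bigMembers L).filter fun f => f.card = 2 := by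
    intro g hg
    obtain ⟨hg, hg2⟩ := Finset.mem_powersetCard.1 hg
    exact Finset.mem_filter.2 ⟨mem_bigMembers.2
      ⟨hL.mem_of_subset hfL (hg.trans hT), hg2.ge⟩, hg2⟩
  have := Finset.card_le_card this
  rw [Finset.card_powersetCard, hT3] at this
  exact this

/-- In units of `1/12` the target `13/4` is 39. A link that is not a cherry has enough surplus to
pay all its neighbours; the case split is on the number of vertices of the link. It is sharp for
four vertices and one pair: surplus 1, with two codegrees equal to 2. -/
theorem IsLowerSet.sum_pairTransfer_le (hL : IsLowerSet (L : Set (Finset V))) (h6 : 6 ≤ L.card)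
    (hnc : ¬ IsCherry L) :
    ∑ u ∈ support L, pairTransfer (openStar L u).card ≤ 12 * coneWeight L - 39 := by
  have hne : L.Nonempty := Finset.card_pos.1 (by omega)
  have hcard := hL.card_eq_one_add hne
  have hw := hL.coneWeight_eq hne
  have hP := card_pairs_div_three_le (L := L)
  have hle : ∑ u ∈ support L, pairTransfer (openStar L u).card ≤ (support L).card := by
    rw [← mul_one ((support L).card : ℝ), ← nsmul_eq_mul, ← Finset.sum_const]
    exact Finset.sum_le_sum fun u _ => pairTransfer_le_one _
  set P := (bigMembers L).filter fun f => f.card = 2 with hPdef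
  have hall : P.card ≤ 2 → ∀ f ∈ bigMembers L, f.card = 2 := by
    intro h f hf
    by_contra h2
    have := hL.three_le_card_pairs hf h2
    rw [← hPdef] at this
    omega
  have hPall : P.card ≤ 2 → P = bigMembers L := fun h => Finset.filter_true_of_mem (hall h)
  have hP0 : (0 : ℝ) ≤ P.card := by positivity
  have hPge : ∀ k : ℕ, k ≤ 3 → k ≤ (bigMembers L).card → (k : ℝ) ≤ P.card := by
    intro k hk hkb
    by_cases h2 : P.card ≤ 2
    · rw [hPall h2]
      exact_mod_cast hkb
    · exact_mod_cast (by omega : k ≤ P.card)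
  rcases (by omega : (support L).card ≤ 2 ∨ (support L).card = 3 ∨ (support L).card = 4 ∨
    (support L).card = 5 ∨ 6 ≤ (support L).card) with hn | hn | hn | hn | hn
  · have h1 : L ⊆ (support L).powerset := fun f hf => Finset.mem_powerset.2 (subset_support hf)
    have h2 := Finset.card_le_card h1
    rw [Finset.card_powerset] at h2
    have h3 : 2 ^ (support L).card ≤ 2 ^ 2 := Nat.pow_le_pow_right (by norm_num) hn
    omega
  · rw [hn] at hle hw
    by_cases h2 : P.card ≤ 2
    · exfalso
      have h3 := hPall h2
      exact hnc ⟨hn, by rw [h3] at h2; omega, hall h2⟩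
    · have : (3 : ℝ) ≤ P.card := by exact_mod_cast (by omega : 3 ≤ P.card)
      push_cast at hle hw
      linarith
  · rw [hn] at hle hw
    push_cast at hle hw
    by_cases h2 : (bigMembers L).card = 1
    · obtain ⟨s, hs⟩ := Finset.card_eq_one.1 h2
      have hP1 : P.card ≤ 2 := by
        have : P.card ≤ (bigMembers L).card := Finset.card_filter_le _ _
        omega
      have hs2 := hall hP1 s (by simp [hs])
      have hsum : ∑ u ∈ support L, pairTransfer (openStar L u).card =
          ∑ u ∈ support L, if u ∈ s then (1 / 2 : ℝ) else 0 := by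
        refine Finset.sum_congr rfl fun u hu => ?_
        rw [hL.card_openStar_eq hu, hs]
        by_cases hus : u ∈ s
        · rw [if_pos hus, openStar, Finset.filter_singleton, if_pos hus]
          norm_num [pairTransfer]
        · rw [if_neg hus, openStar, Finset.filter_singleton, if_neg hus]
          norm_num [pairTransfer]
      have hsub : s ⊆ support L := subset_support (mem_bigMembers.1 (by simp [hs] : s ∈ _)).1
      rw [hsum, ← Finset.sum_filter, Finset.filter_mem_eq_inter, Finset.inter_eq_right.2 hsub,
        Finset.sum_const, hs2, hw, hs, Finset.sum_singleton, hs2]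
      norm_num
    · have := hPge 2 (by norm_num) (by omega)
      push_cast at this
      linarith
  · rw [hn] at hle hw
    push_cast at hle hw
    rcases (bigMembers L).eq_empty_or_nonempty with h0 | h0
    · have hsum : ∑ u ∈ support L, pairTransfer (openStar L u).card = 0 := by
        refine Finset.sum_eq_zero fun u hu => ?_
        rw [hL.card_openStar_eq hu, h0]
        norm_num [pairTransfer, openStar]
      rw [hsum]
      linarith
    · have := hPge 1 (by norm_num) (Finset.card_pos.2 h0)
      push_cast at this
      linarith
  · have : (6 : ℝ) ≤ (support L).card := by exact_mod_cast hn
    linarith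

theorem IsCherry.coneWeight_eq (h : IsCherry L) (hL : IsLowerSet (L : Set (Finset V))) :
    12 * coneWeight L - 39 = -1 := by
  have hne : L.Nonempty := by
    obtain ⟨a, ha⟩ := Finset.card_pos.1 (h.1 ▸ (by norm_num) : 0 < (support L).card)
    exact ⟨_, hL.mem_support.1 ha⟩
  rw [hL.coneWeight_eq hne, h.1, Finset.sum_congr rfl fun f hf => by rw [h.2.2 f hf],
    Finset.sum_const, h.2.1]
  norm_num

theorem IsCherry.exists_centre (h : IsCherry L) :
    ∃ a b c, a ≠ b ∧ a ≠ c ∧ b ≠ c ∧ bigMembers L = {{c, a}, {c, b}} := by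
  obtain ⟨h3, h2, hall⟩ := h
  obtain ⟨s, t, hst, hb⟩ := Finset.card_eq_two.1 h2
  have hs : s ∈ bigMembers L := by simp [hb]
  have ht : t ∈ bigMembers L := by simp [hb]
  have hs2 := hall s hs
  have ht2 := hall t ht
  have hunion := Finset.card_union_add_card_inter s t
  have hle : (s ∪ t).card ≤ 3 := by
    rw [← h3]
    exact Finset.card_le_card (Finset.union_subset (subset_support (mem_bigMembers.1 hs).1)
      (subset_support (mem_bigMembers.1 ht).1))
  obtain ⟨c, hc⟩ := Finset.card_pos.1 (by omega : 0 < (s ∩ t).card)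
  obtain ⟨hcs, hct⟩ := Finset.mem_inter.1 hc
  have key : ∀ s : Finset V, s.card = 2 → c ∈ s → ∃ a, a ≠ c ∧ s = {c, a} := by
    intro s hs2 hcs
    obtain ⟨a, ha⟩ := Finset.card_eq_one.1 (by
      rw [Finset.card_erase_of_mem hcs, hs2] : (s.erase c).card = 1)
    refine ⟨a, ?_, ?_⟩
    · have : a ∈ s.erase c := by simp [ha]
      exact (Finset.mem_erase.1 this).1
    · rw [← ha, Finset.insert_erase hcs]
  obtain ⟨a, hac, rfl⟩ := key s hs2 hcs
  obtain ⟨b, hbc, rfl⟩ := key t ht2 hct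
  exact ⟨a, b, c, fun hab => hst (by rw [hab]), hac, hbc, hb⟩

theorem card_openStar_link_comm (hxy : x ≠ y) :
    (openStar (link E x) y).card = (openStar (link E y) x).card := by
  have key : ∀ x y : V, x ≠ y →
      (openStar (link E x) y).card = (E.filter fun e => x ∈ e ∧ y ∈ e).card := by
    intro x y hxy
    rw [openStar, Finset.card_filter, sum_link, ← Finset.card_filter, openStar,
      Finset.filter_filter]
    congr 1
    ext e
    simp [hxy.symm]
  rw [key x y hxy, key y x hxy.symm]
  simp only [and_comm]

/-- A vertex whose link is a cherry receives enough from its neighbours. -/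
theorem IsLowerSet.one_le_sum_pairTransfer (hE : IsLowerSet (E : Set (Finset V)))
    (hx : IsCherry (link E x)) (D : Finset V) (hD : ∀ v ∈ D, IsCherry (link E v)) :
    1 ≤ ∑ u ∈ support (link E x) \ D, pairTransfer (openStar (link E x) u).card := by
  obtain ⟨a, b, c, hab, hac, hbc, hbig⟩ := hx.exists_centre
  have hLx := hE.isLowerSet_link x
  have hca : ({c, a} : Finset V) ∈ link E x :=
    (mem_bigMembers.1 (by rw [hbig]; simp : ({c, a} : Finset V) ∈ bigMembers (link E x))).1
  have hcb : ({c, b} : Finset V) ∈ link E x :=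
    (mem_bigMembers.1 (by rw [hbig]; simp : ({c, b} : Finset V) ∈ bigMembers (link E x))).1
  obtain ⟨hxca, hxcaE⟩ := mem_link.1 hca
  obtain ⟨hxcb, hxcbE⟩ := mem_link.1 hcb
  simp only [Finset.mem_insert, Finset.mem_singleton, not_or] at hxca hxcb
  have hcs : c ∈ support (link E x) := subset_support hca (by simp)
  have has : a ∈ support (link E x) := subset_support hca (by simp)
  have hbs : b ∈ support (link E x) := subset_support hcb (by simp)
  have hnn : ∀ u ∈ support (link E x) \ D, 0 ≤ pairTransfer (openStar (link E x) u).card :=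
    fun u _ => pairTransfer_nonneg _
  have hdeg : ∀ u ∈ support (link E x), (openStar (link E x) u).card =
      1 + ((if u = c ∨ u = a then 1 else 0) + if u = c ∨ u = b then 1 else 0) := by
    intro u hu
    rw [hLx.card_openStar_eq hu, hbig, openStar, Finset.card_filter, Finset.sum_pair]
    · simp
    · intro h
      have : a ∈ ({c, b} : Finset V) := by rw [← h]; simp
      simp [hac, hab] at this
  -- A centre outside `D` has codegree 3 with `x` and pays 1. If the centre is in `D`, both ends are
  -- outside `D` and, having codegree 2, pay `1/2` each.
  by_cases hcD : c ∈ D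
  · -- the ends of the cherry are not cherries themselves
    have hcc := hD c hcD
    have hend : ∀ p q, p ≠ c → p ≠ q → q ≠ c → x ≠ p → x ≠ q →
        bigMembers (link E x) = {{c, p}, {c, q}} →
        insert x {c, p} ∈ E → insert x {c, q} ∈ E → p ∉ D := by
      intro p q hpc hpq hqc hxp hxq hbig hpE hqE hpD
      have hcbig : ({ {x, p}, {x, q} } : Finset (Finset V)) = bigMembers (link E c) := by
        refine Finset.eq_of_subset_of_card_le ?_ ?_
        · intro f hf
          simp only [Finset.mem_insert, Finset.mem_singleton] at hf
          rcases hf with rfl | rfl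
          · refine mem_bigMembers.2 ⟨mem_link.2 ⟨?_, ?_⟩, by rw [Finset.card_pair hxp]⟩
            · simp [Ne.symm hxca.1, hpc.symm]
            · rwa [Finset.insert_comm]
          · refine mem_bigMembers.2 ⟨mem_link.2 ⟨?_, ?_⟩, by rw [Finset.card_pair hxq]⟩
            · simp [Ne.symm hxca.1, hqc.symm]
            · rwa [Finset.insert_comm]
        · rw [hcc.2.1, Finset.card_pair]
          intro h
          have : p ∈ ({x, q} : Finset V) := by rw [← h]; simp
          simp [hxp.symm, hpq] at this
      obtain ⟨r, s, t, hrs, hrt, hst, hpbig⟩ := (hD p hpD).exists_centre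
      have hxc : ({x, c} : Finset V) ∈ bigMembers (link E p) := by
        refine mem_bigMembers.2 ⟨mem_link.2 ⟨?_, ?_⟩, by rw [Finset.card_pair hxca.1]⟩
        · simp [hxp.symm, hpc]
        · rw [Finset.insert_comm, Finset.pair_comm p c]
          exact hpE
      -- the second pair of the link of `p` meets `{x, c}`
      obtain ⟨w, hwx, hwc, hw⟩ : ∃ w, w ≠ x ∧ w ≠ c ∧
          (({x, w} : Finset V) ∈ link E p ∨ ({c, w} : Finset V) ∈ link E p) := by
        have htr : ({t, r} : Finset V) ∈ link E p :=
          (mem_bigMembers.1 (by rw [hpbig]; simp : _ ∈ bigMembers (link E p))).1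
        have hts : ({t, s} : Finset V) ∈ link E p :=
          (mem_bigMembers.1 (by rw [hpbig]; simp : _ ∈ bigMembers (link E p))).1
        rw [hpbig, Finset.mem_insert, Finset.mem_singleton] at hxc
        have hpair : ∀ r s : V, s ≠ t → r ≠ s → ({t, s} : Finset V) ∈ link E p →
            ({x, c} : Finset V) = {t, r} → ∃ w, w ≠ x ∧ w ≠ c ∧
              (({x, w} : Finset V) ∈ link E p ∨ ({c, w} : Finset V) ∈ link E p) := by
          intro r s hst hrs hts heq
          have hx' : s ∉ ({x, c} : Finset V) := by
            rw [heq]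
            simp [hst, hrs.symm]
          simp only [Finset.mem_insert, Finset.mem_singleton, not_or] at hx'
          have ht : t ∈ ({x, c} : Finset V) := by rw [heq]; simp
          simp only [Finset.mem_insert, Finset.mem_singleton] at ht
          refine ⟨s, hx'.1, hx'.2, ?_⟩
          rcases ht with rfl | rfl
          · exact Or.inl hts
          · exact Or.inr hts
        rcases hxc with hxc | hxc
        · exact hpair r s hst hrs hts hxc
        · exact hpair s r hrt hrs.symm htr hxc
      rcases hw with hw | hw
      · obtain ⟨hpn, hpw⟩ := mem_link.1 hw
        simp only [Finset.mem_insert, Finset.mem_singleton, not_or] at hpn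
        have h1 : ({p, w} : Finset V) ∈ bigMembers (link E x) := by
          refine mem_bigMembers.2 ⟨mem_link.2 ⟨?_, ?_⟩, by rw [Finset.card_pair hpn.2]⟩
          · simp [hxp, hwx.symm]
          · rwa [Finset.insert_comm]
        rw [hbig, Finset.mem_insert, Finset.mem_singleton] at h1
        have h2 : c ∈ ({p, w} : Finset V) := by
          rcases h1 with h1 | h1 <;> rw [h1] <;> simp
        simp [hpc.symm, hwc.symm] at h2
      · obtain ⟨hpn, hpw⟩ := mem_link.1 hw
        simp only [Finset.mem_insert, Finset.mem_singleton, not_or] at hpn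
        have h1 : ({p, w} : Finset V) ∈ bigMembers (link E c) := by
          refine mem_bigMembers.2 ⟨mem_link.2 ⟨?_, ?_⟩, by rw [Finset.card_pair hpn.2]⟩
          · simp [hpc.symm, hwc.symm]
          · rwa [Finset.insert_comm]
        rw [← hcbig, Finset.mem_insert, Finset.mem_singleton] at h1
        have h2 : x ∈ ({p, w} : Finset V) := by
          rcases h1 with h1 | h1 <;> rw [h1] <;> simp
        simp [hxp, hwx.symm] at h2
    have haD := hend a b hac hab hbc hxca.2 hxcb.2 hbig hxcaE hxcbE
    have hbD := hend b a hbc hab.symm hac hxcb.2 hxca.2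
      (by rw [hbig, Finset.pair_comm]) hxcbE hxcaE
    have hsub : ({a, b} : Finset V) ⊆ support (link E x) \ D := by
      intro u hu
      simp only [Finset.mem_insert, Finset.mem_singleton] at hu
      rcases hu with rfl | rfl
      · exact Finset.mem_sdiff.2 ⟨has, haD⟩
      · exact Finset.mem_sdiff.2 ⟨hbs, hbD⟩
    refine le_trans ?_ (Finset.sum_le_sum_of_subset_of_nonneg hsub fun u hu _ => hnn u hu)
    rw [Finset.sum_pair hab, hdeg a has, hdeg b hbs]
    norm_num [pairTransfer, hac, hbc, hab, hab.symm]
  · have h1 := Finset.single_le_sum hnn (Finset.mem_sdiff.2 ⟨hcs, hcD⟩)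
    refine le_trans ?_ h1
    rw [hdeg c hcs]
    norm_num [pairTransfer]

theorem IsLowerSet.alphaValue_three_mul_card_le (hE : IsLowerSet (E : Set (Finset V)))
    (hdeg : ∀ x ∈ support E, 6 ≤ (openStar E x).card) :
    alphaValue 3 3 * (support E).card ≤ ((E.erase ∅).card : ℝ) := by
  classical
  rw [← sum_faceWeight_openStar (F := E) (A := support E) fun e he => subset_support he]
  simp only [faceWeight_openStar]
  set D := (support E).filter fun x => IsCherry (link E x) with hDdef
  have hD : ∀ v ∈ D, IsCherry (link E v) := fun v hv => (Finset.mem_filter.1 hv).2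
  have hDE : D ⊆ support E := Finset.filter_subset _ _
  have hlink : ∀ v, support (link E v) ⊆ support E := fun v u hu =>
    hE.mem_support.2 (hE.mem_of_subset (hE.mem_support_link.1 hu).2 (by simp))
  -- The codegree is symmetric, so the amount `v` pays to `u` can be read off in either link.
  set τ : V → V → ℝ := fun v u =>
    if u ∈ support (link E v) then pairTransfer (openStar (link E v) u).card else 0 with hτ
  have hτnn : ∀ v u, 0 ≤ τ v u := by
    intro v u
    simp only [hτ]
    split_ifs
    · exact pairTransfer_nonneg _
    · exact le_rfl
  have hτsymm : ∀ v u, τ v u = τ u v := by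
    intro v u
    have hiff : u ∈ support (link E v) ↔ v ∈ support (link E u) := by
      rw [hE.mem_support_link, hE.mem_support_link, ne_comm, Finset.pair_comm]
    simp only [hτ, hiff]
    split_ifs with h
    · rw [card_openStar_link_comm (hE.mem_support_link.1 h).1.symm]
    · rfl
  have h1 : ∀ v ∈ support E \ D, ∑ u ∈ D, τ v u ≤ 12 * coneWeight (link E v) - 39 := by
    intro v hv
    obtain ⟨hv, hvD⟩ := Finset.mem_sdiff.1 hv
    have hnc : ¬ IsCherry (link E v) := fun h => hvD (Finset.mem_filter.2 ⟨hv, h⟩)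
    refine le_trans ?_ ((hE.isLowerSet_link v).sum_pairTransfer_le
      (by rw [card_link]; exact hdeg v hv) hnc)
    refine (Finset.sum_le_sum_of_subset_of_nonneg hDE fun u _ _ => hτnn v u).trans (le_of_eq ?_)
    simp only [hτ]
    rw [← Finset.sum_filter, Finset.filter_mem_eq_inter, Finset.inter_eq_right.2 (hlink v)]
  have h2 : ∀ x ∈ D, 1 ≤ ∑ v ∈ support E \ D, τ v x := by
    intro x hx
    refine (hE.one_le_sum_pairTransfer (hD x hx) D hD).trans (le_of_eq ?_)
    simp only [hτsymm _ x]
    simp only [hτ]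
    rw [← Finset.sum_filter]
    congr 1
    ext u
    have := @hlink x u
    simp only [Finset.mem_sdiff, Finset.mem_filter]
    tauto
  have h3 : ∑ x ∈ D, (12 * coneWeight (link E x) - 39) = -(D.card : ℝ) := by
    rw [Finset.sum_congr rfl fun x hx => (hD x hx).coneWeight_eq (hE.isLowerSet_link x),
      Finset.sum_const, nsmul_eq_mul]
    ring
  have h4 := Finset.sum_le_sum h1
  rw [Finset.sum_comm] at h4
  have h5 := Finset.sum_le_sum h2
  rw [Finset.sum_const, nsmul_eq_mul, mul_one] at h5
  have h6 : ∑ v ∈ support E, (12 * coneWeight (link E v) - 39) =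
      12 * ∑ v ∈ support E, coneWeight (link E v) - 39 * (support E).card := by
    rw [Finset.sum_sub_distrib, ← Finset.mul_sum, Finset.sum_const, nsmul_eq_mul]
    ring
  have h7 := Finset.sum_sdiff (f := fun v => 12 * coneWeight (link E v) - 39) hDE
  have h8 : alphaValue 3 3 = 13 / 4 := by norm_num [alphaValue]
  rw [h8]
  linarith

end dimensionThree

/-! ### The extremal complexes. -/

section extremal

/-- A lower set contains lower sets of every smaller size. -/
theorem IsLowerSet.exists_lower_card_add_eq {V : Type*} [DecidableEq V] {C : Finset (Finset V)}
    (hC : IsLowerSet (C : Set (Finset V))) (k : ℕ) (hk : k ≤ C.card) :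
    ∃ D ⊆ C, IsLowerSet (D : Set (Finset V)) ∧ D.card + k = C.card := by
  induction k with
  | zero => exact ⟨C, le_rfl, hC, rfl⟩
  | succ k ih =>
    obtain ⟨D, hDC, hD, hcard⟩ := ih (by omega)
    obtain ⟨a, ha⟩ := D.exists_maximal (Finset.card_pos.1 (by omega))
    refine ⟨D.erase a, (Finset.erase_subset _ _).trans hDC, ?_, ?_⟩
    · intro e f hfe he
      simp only [Finset.mem_coe, Finset.mem_erase] at he ⊢
      refine ⟨?_, hD hfe he.2⟩
      rintro rfl
      exact he.1 (le_antisymm (ha.2 he.2 hfe) hfe)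
    · rw [Finset.card_erase_of_mem ha.1]
      have := Finset.card_pos.2 ⟨a, ha.1⟩
      omega

/-- The embedding of the `i`-th copy. -/
def copyEmbedding (t n : ℕ) (i : Fin t) : Fin n ↪ ULift.{u} (Fin t × Fin n) where
  toFun x := ⟨(i, x)⟩
  inj' x y h := by simpa using h

/-- The disjoint union of `t` copies of a lower set of subsets of `Fin n`. -/
def disjointCopies (t : ℕ) {n : ℕ} (D : Finset (Finset (Fin n)))
    (hD : IsLowerSet (D : Set (Finset (Fin n)))) :
    FinSimplicialComplex (ULift.{u} (Fin t × Fin n)) where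
  edges := insert ∅ (Finset.univ.biUnion fun i =>
    (D.erase ∅).image fun e => e.map (copyEmbedding t n i))
  nonempty := ⟨∅, Finset.mem_insert_self _ _⟩
  down_closed := by
    intro s hs r hr
    rcases r.eq_empty_or_nonempty with rfl | hne
    · exact Finset.mem_insert_self _ _
    simp only [Finset.mem_insert, Finset.mem_biUnion, Finset.mem_univ, true_and,
      Finset.mem_image, Finset.mem_erase] at hs ⊢
    rcases hs with rfl | ⟨i, e, ⟨-, he⟩, rfl⟩
    · exact absurd (Finset.subset_empty.1 hr) hne.ne_empty
    · obtain ⟨f, hf, rfl⟩ := Finset.subset_map_iff.1 hr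
      exact Or.inr ⟨i, f, ⟨by simpa using hne.ne_empty, hD hf he⟩, rfl⟩

variable {t n : ℕ} {D : Finset (Finset (Fin n))} {hD : IsLowerSet (D : Set (Finset (Fin n)))}

theorem card_edges_disjointCopies_le (h0 : ∅ ∈ D) :
    (disjointCopies.{u} t D hD).edges.card ≤ t * (D.card - 1) + 1 := by
  refine (Finset.card_insert_le _ _).trans (Nat.add_le_add_right ?_ 1)
  refine (Finset.card_biUnion_le).trans ?_
  refine (Finset.sum_le_card_nsmul _ _ (D.card - 1) fun i _ => ?_).trans (by simp)
  exact Finset.card_image_le.trans (by rw [Finset.card_erase_of_mem h0])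

theorem card_openStar_le_degree (i : Fin t) (x : Fin n) :
    (openStar D x).card ≤ (disjointCopies.{u} t D hD).degree ⟨(i, x)⟩ := by
  unfold FinSimplicialComplex.degree
  refine Finset.card_le_card_of_injOn (fun e => e.map (copyEmbedding t n i)) ?_ ?_
  · intro e he
    obtain ⟨he, hx⟩ := mem_openStar.1 he
    simp only [Finset.coe_filter, Set.mem_ofPred_eq]
    refine ⟨?_, Finset.mem_map.2 ⟨x, hx, rfl⟩⟩
    refine Finset.mem_insert_of_mem (Finset.mem_biUnion.2 ⟨i, Finset.mem_univ _,
      Finset.mem_image.2 ⟨e, Finset.mem_erase.2 ⟨Finset.ne_empty_of_mem hx, he⟩, rfl⟩⟩)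
  · exact (Finset.map_injective _).injOn

theorem FinSimplicialComplex.isLowerSet_edges {V : Type*} (S : FinSimplicialComplex V) :
    IsLowerSet (S.edges : Set (Finset V)) := fun a b hba ha => S.down_closed a ha b hba

/-- Complexes with large minimum degree and asymptotically few edges per vertex. -/
theorem exists_complex_lt_minDegree {d m : ℕ} (hm : 1 ≤ m) (hdm : m ≤ d) (t : ℕ) :
    ∃ S : FinSimplicialComplex (ULift.{u} (Fin t × Fin (d + 1))),
      (S.edges.card : ℝ) ≤ t * ((2 : ℝ) ^ (d + 1) - m) + 1 ∧
      S.vertexSet.card = t * (d + 1) ∧ ((2 ^ d - m : ℕ) : ℕ∞) < S.minDegree := by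
  have hm2 : m ≤ 2 ^ d := hdm.trans Nat.lt_two_pow_self.le
  have hcardU : (Finset.univ : Finset (Finset (Fin (d + 1)))).card = 2 ^ (d + 1) := by simp
  have hpow : 2 ^ (d + 1) = 2 * 2 ^ d := pow_succ' _ _
  obtain ⟨D, -, hD, hcard⟩ := IsLowerSet.exists_lower_card_add_eq
    (C := (Finset.univ : Finset (Finset (Fin (d + 1))))) (fun _ _ _ _ => by simp) (m - 1)
    (by rw [hcardU]; omega)
  rw [hcardU] at hcard
  have h0 : ∅ ∈ D := hD.empty_mem (Finset.card_pos.1 (by omega))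
  have hstar : ∀ x, 2 ^ d - m + 1 ≤ (openStar D x).card := by
    intro x
    have h1 := card_powerset_filter_mem (A := Finset.univ) (Finset.mem_univ x)
    rw [Finset.card_univ, Fintype.card_fin, Nat.add_sub_cancel] at h1
    -- Of the `2^d` subsets through `x`, at most the `m - 1` removed sets are absent from `D`.
    have h2 : (Finset.univ.powerset.filter fun u => x ∈ u) ⊆ openStar D x ∪ Dᶜ := by
      intro e he
      have he := (Finset.mem_filter.1 he).2
      by_cases h : e ∈ D
      · exact Finset.mem_union_left _ (mem_openStar.2 ⟨h, he⟩)
      · exact Finset.mem_union_right _ (Finset.mem_compl.2 h)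
    have h3 := (Finset.card_le_card h2).trans (Finset.card_union_le _ _)
    rw [Finset.card_compl, h1] at h3
    simp only [Fintype.card_finset, Fintype.card_fin] at h3
    omega
  have hdeg : ∀ v, 2 ^ d - m + 1 ≤ (disjointCopies.{u} t D hD).degree v := by
    rintro ⟨i, x⟩
    exact (hstar x).trans (card_openStar_le_degree i x)
  refine ⟨disjointCopies.{u} t D hD, ?_, ?_, ?_⟩
  · have h1 := card_edges_disjointCopies_le.{u} (t := t) (hD := hD) h0
    have h2 : ((D.card - 1 : ℕ) : ℝ) = (2 : ℝ) ^ (d + 1) - m := by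
      have : D.card - 1 + m = 2 ^ (d + 1) := by omega
      have : ((D.card - 1 : ℕ) : ℝ) + m = 2 ^ (d + 1) := by exact_mod_cast this
      linarith
    rw [← h2]
    exact_mod_cast h1
  · have : (disjointCopies.{u} t D hD).vertexSet = Finset.univ := by
      ext v
      simp only [Finset.mem_univ, iff_true]
      have hv : 0 < (disjointCopies.{u} t D hD).degree v := by
        have := hdeg v
        omega
      obtain ⟨e, he⟩ := Finset.card_pos.1 hv
      obtain ⟨he, hve⟩ := Finset.mem_filter.1 he
      exact Finset.mem_biUnion.2 ⟨e, he, hve⟩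
    rw [this]
    simp
  · refine lt_of_lt_of_le (b := ((2 ^ d - m + 1 : ℕ) : ℕ∞)) ?_ (Finset.le_inf fun v _ => ?_)
    · exact_mod_cast Nat.lt_succ_self _
    · exact_mod_cast hdeg v

end extremal

/-! ### Assembling the two bounds. -/

/-- A lower set in which all degrees exceed `2 ^ d - m` has many members. -/
theorem IsLowerSet.alphaValue_mul_card_le {V : Type*} [DecidableEq V] {E : Finset (Finset V)}
    (hE : IsLowerSet (E : Set (Finset V))) {d m : ℕ} (hm : 1 ≤ m) (hdm : m ≤ d)
    (hdeg : ∀ x ∈ support E, 2 ^ d - m + 1 ≤ (openStar E x).card) :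
    alphaValue d m * (support E).card ≤ ((E.erase ∅).card : ℝ) := by
  rcases le_or_gt m 2 with h2 | h2
  · rw [← sum_faceWeight_openStar (F := E) (A := support E) fun e he => subset_support he,
      mul_comm, ← nsmul_eq_mul, ← Finset.sum_const]
    refine Finset.sum_le_sum fun x hx => ?_
    rw [faceWeight_openStar]
    refine (hE.isLowerSet_link x).alphaValue_le_coneWeight_of_le_two hm h2 ?_
      (hdm.trans Nat.lt_two_pow_self.le)
    rw [card_link]
    exact hdeg x hx
  rcases (by omega : d = 3 ∨ 4 ≤ d) with rfl | hd
  · obtain rfl : m = 3 := by omega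
    exact hE.alphaValue_three_mul_card_le hdeg
  · exact LargeDegrees.alphaValue_mul_card_le ⟨hE, hd, hm, hdm, hdeg⟩

theorem alphaValue_mem_minDegreeConstants {d m : ℕ} (hm : 1 ≤ m) (hdm : m ≤ d) :
    alphaValue d m ∈ minDegreeConstants.{u} (2 ^ d - m) := by
  intro V _ S hS
  by_contra! hlt
  have hE := S.isLowerSet_edges
  have hdeg : ∀ x ∈ support S.edges, 2 ^ d - m + 1 ≤ (openStar S.edges x).card := by
    intro x hx
    have h1 : S.minDegree ≤ (S.degree x : ℕ∞) := Finset.inf_le hx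
    have h2 : ((2 ^ d - m : ℕ) : ℕ∞) < (S.degree x : ℕ∞) := hlt.trans_le h1
    exact Nat.succ_le_of_lt (by exact_mod_cast h2)
  have h1 := hE.alphaValue_mul_card_le hm hdm hdeg
  have h2 := Finset.card_erase_add_one (hE.empty_mem S.nonempty)
  -- The empty edge makes the inequality strict, contradicting `hS`.
  have h3 : ((S.edges.erase ∅).card : ℝ) + 1 = S.edges.card := by exact_mod_cast h2
  have h4 : (S.vertexSet.card : ℝ) = (support S.edges).card := rfl
  rw [h4] at hS
  linarith

theorem le_alphaValue_of_mem_minDegreeConstants {d m : ℕ} (hm : 1 ≤ m) (hdm : m ≤ d) {a : ℝ}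
    (ha : a ∈ minDegreeConstants.{u} (2 ^ d - m)) : a ≤ alphaValue d m := by
  by_contra! hlt
  have hd : (0 : ℝ) < (d : ℝ) + 1 := by positivity
  have hgap : 0 < a * (d + 1) - ((2 : ℝ) ^ (d + 1) - m) := by
    rw [alphaValue, div_lt_iff₀ hd] at hlt
    linarith
  -- With this many copies the gap absorbs the single shared empty edge.
  obtain ⟨t, ht⟩ := exists_nat_gt (1 / (a * (d + 1) - ((2 : ℝ) ^ (d + 1) - m)))
  rw [div_lt_iff₀ hgap] at ht
  obtain ⟨S, h1, h2, h3⟩ := exists_complex_lt_minDegree.{u} hm hdm t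
  refine absurd (ha _ S (h1.trans ?_)) (not_le.2 h3)
  rw [h2]
  push_cast
  linarith

theorem theorem1p1 (d m : ℕ) (hm : 1 ≤ m) (hdm : m ≤ d) :
    IsGreatest (minDegreeConstants.{u} (2 ^ d - m)) (minDegreeAlpha.{u} (2 ^ d - m)) ∧
      minDegreeAlpha.{u} (2 ^ d - m) = ((2 : ℝ) ^ (d + 1) - (m : ℝ)) / ((d : ℝ) + 1) := by
  have h : IsGreatest (minDegreeConstants.{u} (2 ^ d - m)) (alphaValue d m) :=
    ⟨alphaValue_mem_minDegreeConstants hm hdm,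
      fun _ ha => le_alphaValue_of_mem_minDegreeConstants hm hdm ha⟩
  have heq : minDegreeAlpha.{u} (2 ^ d - m) = alphaValue d m := h.csSup_eq
  exact ⟨heq ▸ h, heq⟩
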